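/- Let $n>2k\ge 10$ and $[n]=\{1,\dots,n\}$. A family $\mathcal F\subset\binom{[n]}{k}$ of $k$-element subsets of $[n]$ is *intersecting* if any two of its members have a common element, and two families on $[n]$ are *isomorphic* if a permutation of $[n]$ carries one to the other. For $1\le i\le k$ put $I_i=\{i+1,\dots,k+i\}$ and $$\mathcal J_i=\{I_1,I_i\}\cup\Big\{A\in\tbinom{[n]}{k} : 1\in A,\ A\cap I_1\ne\emptyset,\ A\cap I_i\ne\emptyset\Big\}.$$ For $0\le l\le n-k$ let $\mathcal E_l$ be an inclusion-maximal family among the intersecting families $\mathcal E\subset\binom{[n]}{k}$ that have exactly $l$ members not containing $1$ and, if $l\ge 2$, such that the intersection of these $l$ members has exactly $k-1$ elements. ($\mathcal E_l$ is determined up to isomorphism; $\mathcal E_0$ is a full star and $\mathcal E_1$ a Hilton–Milner family. "$\mathcal F\subset\mathcal E_l$" means that $\mathcal F$ is isomorphic to a subfamily of $\mathcal E_l$.) Let $\mathcal F\subset\binom{[n]}{k}$ be an intersecting family. 1. If $|\mathcal F|>|\mathcal J_3|$, then $\mathcal F\subset\mathcal E_l$ for some $l\in\{0,\dots,k-1,n-k\}$.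 2. Suppose that $|\mathcal F|=|\mathcal J_3|$ and that $\mathcal F\subset\mathcal E_l$ for no $l\in\{0,\dots,k-1,n-k\}$. If $n\ge 2k+2$, then $\mathcal F$ is isomorphic to $\mathcal J_3$. If $n=2k+1$, then $\mathcal F$ is isomorphic to $\mathcal J_i$ for some $i$ with $3\le i\le k$. -/

import Mathlib

namespace LargeIntersecting

/-- The collection of all `k`-element subsets of `[n] = {1, …, n}`. -/
def kSets (n k : ℕ) : Finset (Finset ℕ) :=
  (Finset.Icc 1 n).powersetCard k

/-- The subfamily of the members of `F` that do not contain `i`. -/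
def avoiding (i : ℕ) (F : Finset (Finset ℕ)) : Finset (Finset ℕ) :=
  F.filter (fun A => i ∉ A)

/-- The elements of `[n]` that lie in every member of `F`. -/
def common (n : ℕ) (F : Finset (Finset ℕ)) : Finset ℕ :=
  (Finset.Icc 1 n).filter (fun x => ∀ A ∈ F, x ∈ A)

/-- Families `F`, `G` on `[n]` are isomorphic if a permutation of `[n]` (given as a permutation of
`ℕ` that maps `[n]` onto itself) carries `F` to `G`. -/
def Iso (n : ℕ) (F G : Finset (Finset ℕ)) : Prop :=
  ∃ σ : Equiv.Perm ℕ, (Finset.Icc 1 n).image σ = Finset.Icc 1 n ∧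
    F.image (fun A => A.image σ) = G

/-- The interval `[i + 1, k + i]`. -/
def I (k i : ℕ) : Finset ℕ :=
  Finset.Icc (i + 1) (k + i)

/-- The two sets `I k 1`, `I k i`, together with all `k`-subsets of `[n]` that contain `1` and
meet both of them. -/
def J (n k i : ℕ) : Finset (Finset ℕ) :=
  {I k 1, I k i} ∪ (kSets n k).filter
    (fun A => 1 ∈ A ∧ (A ∩ I k 1).Nonempty ∧ (A ∩ I k i).Nonempty)

/-- `F` is an intersecting family of `k`-subsets of `[n]` with exactly `l` members that avoid `1`;
if `l ≥ 2`, these members have exactly `k - 1` elements in common. -/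
structure EProp (n k l : ℕ) (F : Finset (Finset ℕ)) : Prop where
  subset_kSets : F ⊆ kSets n k
  intersecting : (F : Set (Finset ℕ)).Intersecting
  card_avoiding : (avoiding 1 F).card = l
  card_common : 2 ≤ l → (common n (avoiding 1 F)).card + 1 = k

/-- `E` is a family `E_l`: inclusion-maximal among the families with `EProp n k l`.
For `l = 0` it is the full star centred at `1`, for `l = 1` a Hilton–Milner family. -/
def IsE (n k l : ℕ) (E : Finset (Finset ℕ)) : Prop :=
  Maximal (EProp n k l) E

/-- `F` is contained in `E_l`, the latter being defined up to isomorphism. -/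
def SubE (n k l : ℕ) (F : Finset (Finset ℕ)) : Prop :=
  ∃ E G : Finset (Finset ℕ), IsE n k l E ∧ Iso n F G ∧ G ⊆ E

end LargeIntersecting

/-!
Write `n = r + s + 2` and `k = s + 1`, so that `4 ≤ s < r`. The family `J n k 3` has
`(n - 1 choose k - 1) - deficit r s` members. For a point `i`, the sets of `F` through `i`
(with `i` removed, `link i F`) and those avoiding `i` (`avoiding i F`) cross-intersect on `n - 1`
points, so the complements of either family have a shadow that misses the other family.
Kruskal–Katona bounds this shadow from below; the cascade recursion `ShadowGain.succ` turns it into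
lower bounds for "shadow minus family".

If `|F| ≥ |J n k 3|`, these bounds leave no middle ground (`card_avoiding_le_or_card_link_le`):
every point `i` either is a centre, meaning that at most `r + 1 = n - k` members avoid `i`, or has
degree at most `(n - 2 choose k - 2) + r + 1`.

A centre exists (`exists_card_avoiding_le_of_le_card`). Otherwise shift `F` towards the point `1`. A
shift cannot create a centre: if `S_{1j}(F)` had one, nearly all members of `F` would meet
`{1, j}`, and the members through exactly one of the two points would be cross-intersecting
families that are both larger than a star. So one may assume that `F` is stable under all these
shifts. Then the shadow of `avoiding 1 F` lies in `link 1 F`, and an intersecting family is no larger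
than its shadow (`card_le_card_down_of_intersecting`), so `|F|` is at most twice the degree bound,
which is less than `|J n k 3|` by `choose_add_deficit_le`. Here `k ≥ 5` is needed.

So let `1` be a centre. If at most one member avoids `1`, or the members avoiding `1` share `k - 1`
points, then `F` lies in some `E_l`. Otherwise at least two members avoid `1`. Three or more are
impossible: for `n ≥ 2 k + 2`, three of them already exclude too many sets through `1`
(`card_lt_of_three_le`), and for `n = 2 k + 1` the Kruskal–Katona bound suffices
(`shadowGain_of_three_le`). With exactly two, inclusion–exclusion gives `|F| ≤ |J n k 3|`, and in
the case of equality `F` consists of these two sets and all `k`-sets through `1` that meet both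
(`eq_full_of_card_avoiding_eq_two`); such a family is determined up to isomorphism by the size of
the intersection of the two sets (`iso_full`).
-/

namespace LargeIntersecting
open Finset
open scoped FinsetFamily

/-! ### Kruskal–Katona for finite sets of naturals -/

/-- The `s`-element subsets of the members of `𝒜`. -/
def down (s : ℕ) (𝒜 : Finset (Finset ℕ)) : Finset (Finset ℕ) :=
  𝒜.biUnion fun a => a.powersetCard s

lemma mem_down {s : ℕ} {𝒜 : Finset (Finset ℕ)} {t : Finset ℕ} :
    t ∈ down s 𝒜 ↔ ∃ a ∈ 𝒜, t ⊆ a ∧ #t = s := by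
  simp [down, mem_powersetCard]

lemma down_mono {s : ℕ} {𝒜 ℬ : Finset (Finset ℕ)} (h : 𝒜 ⊆ ℬ) : down s 𝒜 ⊆ down s ℬ :=
  biUnion_subset_biUnion_of_subset_left _ h

lemma subset_range_of_colex_lt {N : ℕ} {s t : Finset ℕ} (hs : s ⊆ range N)
    (h : toColex t < toColex s) : t ⊆ range N := fun x hx =>
  mem_range.2 (Colex.forall_lt_mono h.le (fun _ ha => mem_range.1 (hs ha)) x hx)

lemma exists_isInitSeg (r N b : ℕ) (hb : b ≤ N.choose r) :
    ∃ 𝒞 : Finset (Finset ℕ), 𝒞 ⊆ powersetCard r (range N) ∧ Colex.IsInitSeg 𝒞 r ∧ #𝒞 = b := by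
  induction b with
  | zero => exact ⟨∅, by simp, by simp, by simp⟩
  | succ b ih =>
    obtain ⟨𝒞, hsub, hinit, hcard⟩ := ih (by omega)
    have hne : (powersetCard r (range N) \ 𝒞).Nonempty := by
      rw [← card_pos, card_sdiff_of_subset hsub, card_powersetCard, card_range]
      omega
    obtain ⟨t, ht, hmin⟩ := exists_min_image _ (fun u => toColex u) hne
    rw [mem_sdiff, mem_powersetCard] at ht
    refine ⟨insert t 𝒞, ?_, ⟨?_, ?_⟩, ?_⟩
    · exact insert_subset (mem_powersetCard.2 ht.1) hsub
    · intro u hu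
      rcases mem_insert.1 (mem_coe.1 hu) with rfl | hu
      · exact ht.1.2
      · exact hinit.1 hu
    · intro u v hu hv
      rcases mem_insert.1 hu with rfl | hu
      · by_contra hv'
        have hv1 : v ∉ 𝒞 := fun h => hv' (mem_insert_of_mem h)
        have := hmin v (mem_sdiff.2 ⟨mem_powersetCard.2
          ⟨subset_range_of_colex_lt ht.1.1 hv.1, hv.2⟩, hv1⟩)
        exact absurd hv.1 (not_lt.2 this)
      · exact mem_insert_of_mem (hinit.2 hu hv)
    · rw [card_insert_of_notMem ht.2, hcard]

/-- The traces on `Fin N` of the members of `𝒜` contained in `{0, …, N - 1}`. -/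
def toFin (N : ℕ) (𝒜 : Finset (Finset ℕ)) : Finset (Finset (Fin N)) :=
  univ.filter fun t => t.image Fin.val ∈ 𝒜

lemma mem_toFin {N : ℕ} {𝒜 : Finset (Finset ℕ)} {t : Finset (Fin N)} :
    t ∈ toFin N 𝒜 ↔ t.image Fin.val ∈ 𝒜 := by simp [toFin]

lemma image_toFin {N : ℕ} {𝒜 : Finset (Finset ℕ)} (h : ∀ a ∈ 𝒜, a ⊆ range N) :
    (toFin N 𝒜).image (fun t => t.image Fin.val) = 𝒜 := by
  ext a
  simp only [mem_image, mem_toFin]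
  constructor
  · rintro ⟨t, ht, rfl⟩
    exact ht
  · intro ha
    have : (univ.filter fun i : Fin N => (i : ℕ) ∈ a).image Fin.val = a := by
      ext y
      simp only [mem_image, mem_filter, mem_univ, true_and]
      constructor
      · rintro ⟨i, hi, rfl⟩
        exact hi
      · intro hy
        exact ⟨⟨y, mem_range.1 (h a ha hy)⟩, hy, rfl⟩
    exact ⟨_, by rwa [this], this⟩

lemma card_toFin {N : ℕ} {𝒜 : Finset (Finset ℕ)} (h : ∀ a ∈ 𝒜, a ⊆ range N) :
    #(toFin N 𝒜) = #𝒜 := by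
  conv_rhs => rw [← image_toFin h]
  rw [card_image_of_injective _ (image_injective Fin.val_injective)]

lemma shadow_iterate_toFin {N r s : ℕ} {𝒜 : Finset (Finset ℕ)} (h : ∀ a ∈ 𝒜, a ⊆ range N)
    (hr : (𝒜 : Set (Finset ℕ)).Sized r) (hsr : s ≤ r) :
    ∂^[r - s] (toFin N 𝒜) = toFin N (down s 𝒜) := by
  ext t
  rw [mem_shadow_iterate_iff_exists_mem_card_add, mem_toFin, mem_down,
    card_image_of_injective _ Fin.val_injective]
  constructor
  · rintro ⟨a, ha, hta, hc⟩
    rw [mem_toFin] at ha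
    refine ⟨_, ha, image_subset_image hta, ?_⟩
    have := hr ha
    rw [card_image_of_injective _ Fin.val_injective] at this
    omega
  · rintro ⟨a, ha, hta, hc⟩
    rw [← image_toFin h, mem_image] at ha
    obtain ⟨u, hu, rfl⟩ := ha
    have := hr (mem_toFin.1 hu)
    rw [card_image_of_injective _ Fin.val_injective] at this
    exact ⟨u, hu, (image_subset_image_iff Fin.val_injective).1 hta, by omega⟩

lemma down_subset_range {N s : ℕ} {𝒜 : Finset (Finset ℕ)} (h : ∀ a ∈ 𝒜, a ⊆ range N) :
    ∀ a ∈ down s 𝒜, a ⊆ range N := by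
  intro a ha
  obtain ⟨b, hb, hab, -⟩ := mem_down.1 ha
  exact hab.trans (h b hb)

/-- Kruskal–Katona for families of finite sets of naturals. -/
lemma exists_isInitSeg_card_down_le {r s : ℕ} (hsr : s ≤ r) {𝒜 : Finset (Finset ℕ)}
    (hr : (𝒜 : Set (Finset ℕ)).Sized r) :
    ∃ 𝒞 : Finset (Finset ℕ), Colex.IsInitSeg 𝒞 r ∧ #𝒞 = #𝒜 ∧ #(down s 𝒞) ≤ #(down s 𝒜) := by
  obtain ⟨N, hN⟩ : ∃ N, ∀ a ∈ 𝒜, a ⊆ range N := by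
    refine ⟨(𝒜.biUnion id).sup id + 1, fun a ha x hx => mem_range.2 (Nat.lt_succ_of_le ?_)⟩
    exact le_sup (f := id) (mem_biUnion.2 ⟨a, ha, hx⟩)
  have hb : #𝒜 ≤ N.choose r := by
    rw [← card_range N, ← card_powersetCard]
    exact card_le_card fun a ha => mem_powersetCard.2 ⟨hN a ha, hr ha⟩
  obtain ⟨𝒞, hsub, hinit, hcard⟩ := exists_isInitSeg r N _ hb
  have hC : ∀ a ∈ 𝒞, a ⊆ range N := fun a ha => (mem_powersetCard.1 (hsub ha)).1
  refine ⟨𝒞, hinit, hcard, ?_⟩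
  rw [← card_toFin (down_subset_range hC), ← card_toFin (down_subset_range hN),
    ← shadow_iterate_toFin hC hinit.1 hsr, ← shadow_iterate_toFin hN hr hsr]
  refine iterated_kk (r := r) ?_ (by rw [card_toFin hC, card_toFin hN, hcard]) ⟨?_, ?_⟩
  · intro t ht
    have := hr (mem_toFin.1 (mem_coe.1 ht))
    rwa [card_image_of_injective _ Fin.val_injective] at this
  · intro t ht
    have := hinit.1 (mem_toFin.1 (mem_coe.1 ht))
    rwa [card_image_of_injective _ Fin.val_injective] at this
  · rintro u v hu ⟨hlt, hv⟩
    rw [mem_toFin] at hu ⊢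
    refine hinit.2 hu ⟨?_, ?_⟩
    · rwa [Colex.toColex_image_lt_toColex_image Fin.val_strictMono]
    · rwa [card_image_of_injective _ Fin.val_injective]

lemma isInitSeg_powersetCard_range (r x : ℕ) :
    Colex.IsInitSeg (powersetCard r (range x)) r := by
  refine ⟨Set.sized_powersetCard _ _, fun u v hu hv => ?_⟩
  exact mem_powersetCard.2 ⟨subset_range_of_colex_lt (mem_powersetCard.1 hu).1 hv.1, hv.2⟩

lemma powersetCard_subset_of_isInitSeg {r x : ℕ} {𝒞 : Finset (Finset ℕ)}
    (h : Colex.IsInitSeg 𝒞 r) (hc : x.choose r ≤ #𝒞) : powersetCard r (range x) ⊆ 𝒞 := by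
  rcases (isInitSeg_powersetCard_range r x).total h with h1 | h1
  · exact h1
  · rw [eq_of_subset_of_card_le h1 (by simpa using hc)]

lemma subset_powersetCard_of_isInitSeg {r x : ℕ} {𝒞 : Finset (Finset ℕ)}
    (h : Colex.IsInitSeg 𝒞 r) (hc : #𝒞 ≤ x.choose r) : 𝒞 ⊆ powersetCard r (range x) := by
  rcases (isInitSeg_powersetCard_range r x).total h with h1 | h1
  · rw [eq_of_subset_of_card_le h1 (by simpa using hc)]
  · exact h1

/-- Every `r`-uniform family of size `b` has at least `b + w` sets of size `s` below it. -/
def ShadowGain (r s b : ℕ) (w : ℤ) : Prop :=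
  ∀ 𝒜 : Finset (Finset ℕ), (𝒜 : Set (Finset ℕ)).Sized r → #𝒜 = b → (b : ℤ) + w ≤ #(down s 𝒜)

lemma ShadowGain.mono {r s b : ℕ} {w w' : ℤ} (h : ShadowGain r s b w) (hw : w' ≤ w) :
    ShadowGain r s b w' := fun 𝒜 h1 h2 => by
  have := h 𝒜 h1 h2
  omega

lemma ShadowGain.le_card_down {r s b : ℕ} {w : ℤ} (h : ShadowGain r s b w)
    {𝒜 : Finset (Finset ℕ)} (hr : (𝒜 : Set (Finset ℕ)).Sized r) (hb : b ≤ #𝒜) :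
    (b : ℤ) + w ≤ #(down s 𝒜) := by
  obtain ⟨𝒜', hsub, hcard⟩ := exists_subset_card_eq hb
  have h1 := h 𝒜' (fun a ha => hr (hsub ha)) hcard
  have h2 := card_le_card (down_mono (s := s) hsub)
  omega

lemma ShadowGain.of_isInitSeg {r s b : ℕ} {w : ℤ} (hsr : s ≤ r)
    (h : ∀ 𝒞 : Finset (Finset ℕ), Colex.IsInitSeg 𝒞 r → #𝒞 = b → (b : ℤ) + w ≤ #(down s 𝒞)) :
    ShadowGain r s b w := by
  intro 𝒜 hr hb
  obtain ⟨𝒞, hinit, hcard, hle⟩ := exists_isInitSeg_card_down_le hsr hr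
  have := h 𝒞 hinit (hcard.trans hb)
  omega

/-- In the `r + s` points the inclusion relation between `r`-sets and `s`-sets is regular of equal
degree `(r choose s)` on both sides. -/
lemma card_le_card_down_of_subset {r s : ℕ} (hsr : s ≤ r) {𝒜 : Finset (Finset ℕ)}
    (h : 𝒜 ⊆ powersetCard r (range (r + s))) : #𝒜 ≤ #(down s 𝒜) := by
  have hpos : 0 < r.choose s := Nat.choose_pos hsr
  refine Nat.le_of_mul_le_mul_right (card_mul_le_card_mul (fun a t => t ⊆ a) ?_ ?_) hpos
  · intro a ha
    rw [← (mem_powersetCard.1 (h ha)).2, ← card_powersetCard]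
    refine card_le_card fun t ht => ?_
    rw [mem_powersetCard] at ht
    exact mem_filter.2 ⟨mem_down.2 ⟨a, ha, ht⟩, ht.1⟩
  · intro t ht
    obtain ⟨a0, ha0, ht0, htc⟩ := mem_down.1 ht
    have htr : t ⊆ range (r + s) := ht0.trans (mem_powersetCard.1 (h ha0)).1
    have hcard : #(range (r + s) \ t) = r := by
      rw [card_sdiff_of_subset htr, card_range, htc]; omega
    calc #(bipartiteBelow (fun a t => t ⊆ a) 𝒜 t)
        ≤ #(powersetCard (r - s) (range (r + s) \ t)) := by
          refine card_le_card_of_injOn (fun a => a \ t) ?_ ?_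
          · intro a ha
            obtain ⟨ha, hta⟩ := mem_filter.1 (mem_coe.1 ha)
            obtain ⟨h1, h2⟩ := mem_powersetCard.1 (h ha)
            refine mem_coe.2 (mem_powersetCard.2 ⟨sdiff_subset_sdiff h1 le_rfl, ?_⟩)
            rw [card_sdiff_of_subset hta, h2, htc]
          · intro a ha b hb hab
            have ha' := (mem_filter.1 (mem_coe.1 ha)).2
            have hb' := (mem_filter.1 (mem_coe.1 hb)).2
            rw [← sdiff_union_of_subset ha', ← sdiff_union_of_subset hb']
            exact congrArg (· ∪ t) hab
      _ = r.choose s := by rw [card_powersetCard, hcard, Nat.choose_symm hsr]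

lemma shadowGain_zero {r s b : ℕ} (hsr : s ≤ r) (hb : b ≤ (r + s).choose r) :
    ShadowGain r s b 0 := by
  refine ShadowGain.of_isInitSeg hsr fun 𝒞 hinit hc => ?_
  have := card_le_card_down_of_subset hsr
    (subset_powersetCard_of_isInitSeg (x := r + s) hinit (by omega))
  omega

/-- The cascade recursion: an initial segment of size between `(x choose r + 1)` and
`(x + 1 choose r + 1)` consists of all `(r + 1)`-subsets of `x` points and of sets through one
further point. -/
lemma ShadowGain.succ {r s b x : ℕ} {w : ℤ} (hsr : s ≤ r) (h : ShadowGain r s b w)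
    (hb : b ≤ x.choose r) (hx : r + 1 ≤ x) :
    ShadowGain (r + 1) (s + 1) (x.choose (r + 1) + b)
      (x.choose (s + 1) - x.choose (r + 1) + w) := by
  refine ShadowGain.of_isInitSeg (by omega) fun 𝒞 hinit hc => ?_
  have h1 : powersetCard (r + 1) (range x) ⊆ 𝒞 :=
    powersetCard_subset_of_isInitSeg hinit (by omega)
  have h2 : 𝒞 ⊆ powersetCard (r + 1) (range (x + 1)) := by
    refine subset_powersetCard_of_isInitSeg hinit ?_
    rw [hc, Nat.choose_succ_succ']
    omega
  set 𝒟 := (𝒞.filter fun a => x ∈ a).image fun a => a.erase x with h𝒟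
  have hfilter : 𝒞.filter (fun a => x ∉ a) = powersetCard (r + 1) (range x) := by
    ext a
    rw [mem_filter]
    constructor
    · rintro ⟨ha, hxa⟩
      obtain ⟨h3, h4⟩ := mem_powersetCard.1 (h2 ha)
      refine mem_powersetCard.2 ⟨fun y hy => ?_, h4⟩
      have := mem_range.1 (h3 hy)
      have : y ≠ x := fun h => hxa (h ▸ hy)
      exact mem_range.2 (by omega)
    · intro ha
      exact ⟨h1 ha, fun hxa => by simpa using (mem_powersetCard.1 ha).1 hxa⟩
  have hcard𝒟 : #𝒟 = b := by
    rw [h𝒟, card_image_of_injOn]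
    · have := card_filter_add_card_filter_not (s := 𝒞) (fun a => x ∈ a)
      rw [hfilter, card_powersetCard, card_range] at this
      omega
    · intro a ha c hc hac
      have ha' := (mem_filter.1 (mem_coe.1 ha)).2
      have hc' := (mem_filter.1 (mem_coe.1 hc)).2
      rw [← insert_erase ha', ← insert_erase hc']
      exact congrArg (insert x) hac
  have hxD : ∀ a ∈ 𝒟, x ∉ a := by
    intro a ha
    obtain ⟨c, -, rfl⟩ := mem_image.1 ha
    exact notMem_erase _ _
  have hsized : (𝒟 : Set (Finset ℕ)).Sized r := by
    intro a ha
    obtain ⟨c, hc, rfl⟩ := mem_image.1 (mem_coe.1 ha)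
    obtain ⟨hc, hxc⟩ := mem_filter.1 hc
    rw [card_erase_of_mem hxc, hinit.1 hc]
    rfl
  have hD := h 𝒟 hsized hcard𝒟
  have hxdown : ∀ t ∈ down s 𝒟, x ∉ t := by
    intro t ht hxt
    obtain ⟨a, ha, hta, -⟩ := mem_down.1 ht
    exact hxD a ha (hta hxt)
  have hsub : powersetCard (s + 1) (range x) ∪ (down s 𝒟).image (insert x) ⊆ down (s + 1) 𝒞 := by
    refine union_subset ?_ ?_
    · intro t ht
      obtain ⟨ht1, ht2⟩ := mem_powersetCard.1 ht
      obtain ⟨u, htu, hu, huc⟩ := exists_subsuperset_card_eq (n := r + 1) ht1 (by omega)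
        (by simpa using hx)
      exact mem_down.2 ⟨u, h1 (mem_powersetCard.2 ⟨hu, huc⟩), htu, ht2⟩
    · intro t ht
      obtain ⟨u, hu, rfl⟩ := mem_image.1 ht
      obtain ⟨a, ha, hua, huc⟩ := mem_down.1 hu
      obtain ⟨c, hc, rfl⟩ := mem_image.1 ha
      obtain ⟨hc, hxc⟩ := mem_filter.1 hc
      refine mem_down.2 ⟨c, hc, ?_, ?_⟩
      · exact insert_subset hxc (hua.trans (erase_subset _ _))
      · rw [card_insert_of_notMem (hxdown u hu), huc]
  have hdisj : Disjoint (powersetCard (s + 1) (range x)) ((down s 𝒟).image (insert x)) := by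
    rw [disjoint_left]
    intro t ht ht'
    obtain ⟨u, -, rfl⟩ := mem_image.1 ht'
    simpa using (mem_powersetCard.1 ht).1 (mem_insert_self x u)
  have hle := card_le_card hsub
  rw [card_union_of_disjoint hdisj, card_powersetCard, card_range, card_image_of_injOn] at hle
  · push_cast
    omega
  · intro u hu v hv huv
    rw [← erase_insert (hxdown u hu), ← erase_insert (hxdown v hv)]
    exact congrArg (fun a => a.erase x) huv

/-! ### Numerical estimates for shadows -/

lemma choose_le_choose_of_le_add {x r s : ℕ} (hsr : s ≤ r) (hx : x ≤ r + s) :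
    x.choose r ≤ x.choose s := by
  rcases lt_or_ge x r with h | h
  · simp [Nat.choose_eq_zero_of_lt h]
  have h1 := Nat.choose_mul (n := x) hsr
  have h2 : (x - s).choose (r - s) ≤ r.choose s := by
    rw [← Nat.choose_symm hsr]
    exact Nat.choose_le_choose _ (by omega)
  have h3 : 0 < r.choose s := Nat.choose_pos hsr
  refine Nat.le_of_mul_le_mul_right ?_ h3
  rw [h1]
  exact Nat.mul_le_mul_left _ h2

/-- The difference `(x choose s + 1) - (x choose r + 1)` increases with `x` up to `r + s + 1`. -/
lemma choose_sub_choose_mono {r s x y : ℕ} (hsr : s ≤ r) (hxy : x ≤ y) (hy : y ≤ r + s + 1) :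
    x.choose (s + 1) + y.choose (r + 1) ≤ y.choose (s + 1) + x.choose (r + 1) := by
  induction y, hxy using Nat.le_induction with
  | base => omega
  | succ y hxy ih =>
    have := ih (by omega)
    have := choose_le_choose_of_le_add hsr (show y ≤ r + s by omega)
    rw [Nat.choose_succ_succ' y s, Nat.choose_succ_succ' y r]
    omega

/-- The first step of the cascade representation of `b`. -/
lemma exists_cascade {r b x y : ℕ} (hxy : x ≤ y) (h1 : x.choose (r + 1) ≤ b)
    (h2 : b ≤ (y + 1).choose (r + 1)) :
    ∃ z c, x ≤ z ∧ z ≤ y ∧ c ≤ z.choose r ∧ b = z.choose (r + 1) + c := by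
  induction y, hxy using Nat.le_induction with
  | base =>
    rw [Nat.choose_succ_succ'] at h2
    exact ⟨x, b - x.choose (r + 1), le_rfl, le_rfl, by omega, by omega⟩
  | succ y hxy ih =>
    rcases le_total b ((y + 1).choose (r + 1)) with h | h
    · obtain ⟨z, c, hz⟩ := ih h
      exact ⟨z, c, hz.1, by omega, hz.2.2⟩
    · rw [Nat.choose_succ_succ' (y + 1)] at h2
      exact ⟨y + 1, b - (y + 1).choose (r + 1), by omega, le_rfl, by omega, by omega⟩

lemma shadowGain_of_choose_le {r s b x : ℕ} (hsr : s ≤ r) (hrx : r + 1 ≤ x) (hx : x ≤ r + s)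
    (h1 : x.choose (r + 1) ≤ b) (h2 : b ≤ (r + s + 1).choose (r + 1)) :
    ShadowGain (r + 1) (s + 1) b (x.choose (s + 1) - x.choose (r + 1)) := by
  obtain ⟨z, c, hxz, hz, hc, rfl⟩ := exists_cascade hx h1 h2
  refine ((shadowGain_zero hsr (hc.trans (Nat.choose_le_choose _ hz))).succ hsr hc
    (by omega)).mono ?_
  have := choose_sub_choose_mono hsr hxz (by omega)
  omega

lemma shadowGain_of_succ_le {r s b : ℕ} (hsr : s ≤ r) (hs : 3 ≤ s) (h1 : r + 3 ≤ b)
    (h2 : b ≤ (r + s + 1).choose (r + 1)) :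
    ShadowGain (r + 1) (s + 1) b ((r + 2).choose (s + 1) - (r + 2) + (r.choose s - 1)) := by
  obtain ⟨r, rfl⟩ : ∃ q, r = q + 1 := ⟨r - 1, by omega⟩
  obtain ⟨s, rfl⟩ : ∃ q, s = q + 1 := ⟨s - 1, by omega⟩
  have hch : (r + 3).choose (r + 1 + 1) = r + 3 := Nat.choose_succ_self_right _
  obtain ⟨z, c, hxz, hz, hc, hb⟩ := exists_cascade (x := r + 3) (y := r + s + 2) (r := r + 1)
    (b := b) (by omega) (by omega) (by convert h2 using 2; omega)
  have hr1 : (r + 1).choose (r + 1) = 1 := Nat.choose_self _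
  rcases hxz.eq_or_lt with rfl | hlt
  · have h0 : ShadowGain (r + 1) (s + 1) c ((r + 1).choose (s + 1) - (r + 1).choose (r + 1)) := by
      refine shadowGain_of_choose_le (by omega) le_rfl (by omega) (by omega) ?_
      exact hc.trans (Nat.choose_le_choose _ (by omega))
    have := h0.succ (by omega) hc (by omega)
    rw [hb]
    refine this.mono ?_
    rw [hch, hr1]
    push_cast
    ring_nf
    omega
  · rw [hb]
    refine ((shadowGain_zero (by omega)
      (hc.trans (Nat.choose_le_choose _ (by omega)))).succ (by omega) hc (by omega)).mono ?_
    have e1 := choose_sub_choose_mono (r := r + 1) (s := s + 1) (x := r + 4) (y := z) (by omega)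
      (by omega) (by omega)
    have e2 := choose_sub_choose_mono (r := r) (s := s) (x := r + 1) (y := r + 3) (by omega)
      (by omega) (by omega)
    rw [Nat.choose_succ_succ' (r + 3) (s + 1), Nat.choose_succ_succ' (r + 3) (r + 1), hch] at e1
    rw [hr1] at e2
    push_cast
    have : (r + 1 + 2).choose (s + 1 + 1) = (r + 3).choose (s + 1 + 1) := rfl
    omega

/-- The number of `s`-subsets of `r + s + 1` points that are disjoint from one of two given
`(s + 1)`-sets with `s - 1` common points, less two. By this amount `J n k 3` is smaller than the
full star when `n = r + s + 2` and `k = s + 1`. -/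
def deficit (r s : ℕ) : ℤ := 2 * r.choose s - (r - 2).choose s - 2

lemma le_choose {a c : ℕ} (hc : 1 ≤ c) (hca : c + 1 ≤ a) : a ≤ a.choose c := by
  induction a, hca using Nat.le_induction with
  | base => rw [Nat.choose_succ_self_right]
  | succ a hca ih =>
    obtain ⟨c, rfl⟩ : ∃ q, c = q + 1 := ⟨c - 1, by omega⟩
    rw [Nat.choose_succ_succ']
    have : 0 < a.choose c := Nat.choose_pos (by omega)
    omega

lemma add_two_le_choose {a c : ℕ} (hc : 2 ≤ c) (hca : c + 2 ≤ a) : a + 2 ≤ a.choose c := by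
  induction a, hca using Nat.le_induction with
  | base =>
    rw [Nat.choose_symm_add]
    induction c, hc using Nat.le_induction with
    | base => decide
    | succ c hc ih =>
      have e : (c + 1 + 2).choose 2 = (c + 2).choose 1 + (c + 2).choose 2 :=
        Nat.choose_succ_succ' _ _
      rw [Nat.choose_one_right] at e
      omega
  | succ a hca ih =>
    obtain ⟨c, rfl⟩ : ∃ q, c = q + 1 := ⟨c - 1, by omega⟩
    rw [Nat.choose_succ_succ']
    have : 0 < a.choose c := Nat.choose_pos (by omega)
    omega

/-- The middle range: families of at least `r + 2` sets, up to the size of the complements of a star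
on `r + s` points, beat the deficit of `J n k 3`. -/
lemma shadowGain_of_add_two_le {r s b : ℕ} (hs : 4 ≤ s) (hsr : s + 1 ≤ r) (h1 : r + 2 ≤ b)
    (h2 : b ≤ (r + s - 1).choose r) : ShadowGain r s b (deficit r s + 1) := by
  obtain ⟨a, rfl⟩ : ∃ q, r = q + 1 + 1 := ⟨r - 2, by omega⟩
  obtain ⟨c, rfl⟩ : ∃ q, s = q + 1 + 1 + 1 := ⟨s - 3, by omega⟩
  refine (shadowGain_of_succ_le (r := a + 1) (s := c + 1 + 1) (by omega) (by omega) (by omega)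
    (by convert h2 using 2; omega)).mono ?_
  have e1 := le_choose (a := a) (c := c + 1) (by omega) (by omega)
  have e2 : 0 < a.choose c := Nat.choose_pos (by omega)
  have e3 : a + 1 + 1 - 2 = a := rfl
  have e4 : a.choose (c + 2) = a.choose (c + 1 + 1) := rfl
  have e5 : a.choose (c + 2 + 1) = a.choose (c + 1 + 1 + 1) := rfl
  have e6 : a.choose (c + 3) = a.choose (c + 1 + 1 + 1) := rfl
  simp only [deficit, e3, Nat.choose_succ_succ']
  push_cast
  omega

/-- For `r = s + 1`, that is `n = 2 k + 1`, already three sets beat the deficit of `J n k 3`. -/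
lemma shadowGain_of_three_le {s b : ℕ} (hs : 4 ≤ s) (h1 : 3 ≤ b) (h2 : b ≤ s + 2) :
    ShadowGain (s + 1) s b (deficit (s + 1) s + 1) := by
  obtain ⟨s, rfl⟩ : ∃ q, s = q + 3 := ⟨s - 3, by omega⟩
  have h0 : (s + 1 + 1).choose (s + 1 + 1) = 1 := Nat.choose_self _
  have h1' : (s + 3).choose (s + 3) = 1 := Nat.choose_self _
  have h2' : (s + 4).choose (s + 4) = 1 := Nat.choose_self _
  have h3 : (s + 1 + 1).choose (s + 1) = s + 2 := Nat.choose_succ_self_right _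
  have h4 : (s + 3).choose (s + 2) = s + 3 := Nat.choose_succ_self_right _
  have h5 : (s + 4).choose (s + 3) = s + 4 := Nat.choose_succ_self_right _
  have h6 : (s + 2).choose (s + 3) = 0 := Nat.choose_succ_self _
  obtain ⟨c, rfl⟩ : ∃ c, b = c + 1 + 1 := ⟨b - 2, by omega⟩
  have hc : c ≤ (s + 1 + s + 1).choose (s + 1 + 1) := by
    have := Nat.choose_le_choose (s + 1 + 1) (show s + 3 ≤ s + 1 + s + 1 by omega)
    change (s + 3).choose (s + 2) ≤ _ at this
    omega
  have g1 : ShadowGain (s + 1 + 1) (s + 1) c ((s + 1 + 1).choose (s + 1) - 1) := by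
    have := shadowGain_of_choose_le (r := s + 1) (s := s) (x := s + 1 + 1) (b := c) (by omega)
      le_rfl (by omega) (by omega) hc
    rwa [h0] at this
  have g2 := g1.succ (x := s + 3) (by omega) (by change c ≤ (s + 3).choose (s + 2); omega)
    (by omega)
  have g3 := g2.succ (x := s + 4) (by omega)
    (by change (s + 3).choose (s + 3) + c ≤ (s + 4).choose (s + 3); omega) (by omega)
  change ShadowGain (s + 4) (s + 3) ((s + 4).choose (s + 4) + ((s + 3).choose (s + 3) + c))
    ((s + 4).choose (s + 3) - (s + 4).choose (s + 4) + ((s + 3).choose (s + 2)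
      - (s + 3).choose (s + 3) + ((s + 1 + 1).choose (s + 1) - 1))) at g3
  have h7 : deficit (s + 3 + 1) (s + 3) = 2 * (s + 4) - 2 := by
    have e1 : (s + 3 + 1).choose (s + 3) = s + 4 := h5
    have e2 : (s + 3 + 1 - 2).choose (s + 3) = 0 := h6
    rw [deficit, e1, e2]
    push_cast
    ring
  rw [h1', h2', h3, h4, h5] at g3
  have e : c + 1 + 1 = 1 + (1 + c) := by ring
  rw [e, h7]
  refine g3.mono ?_
  push_cast
  omega

/-- With `n = r + s + 2` and `k = s + 1`: twice the degree bound `(n - 2 choose k - 2) + r + 1` of a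
point that is not a centre is less than the size of `J n k 3`. -/
lemma choose_add_deficit_le {r s : ℕ} (hs : 4 ≤ s) (hsr : s + 1 ≤ r) :
    ((r + s).choose (s - 1) : ℤ) + deficit r s + 2 * r + 3 ≤ (r + s).choose s := by
  have quad : ∀ q : ℕ, (q + 9).choose 1 + 2 * (q + 5).choose 2 ≤
      (q + 9).choose 2 + (q + 3).choose 2 := by
    intro q
    induction q with
    | zero => decide
    | succ q ih =>
      have e1 : (q + 1 + 9).choose 2 = (q + 9).choose 1 + (q + 9).choose 2 :=
        Nat.choose_succ_succ' _ _
      have e2 : (q + 1 + 5).choose 2 = (q + 5).choose 1 + (q + 5).choose 2 :=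
        Nat.choose_succ_succ' _ _
      have e3 : (q + 1 + 3).choose 2 = (q + 3).choose 1 + (q + 3).choose 2 :=
        Nat.choose_succ_succ' _ _
      simp only [Nat.choose_one_right] at *
      omega
  have cubic : ∀ q : ℕ, (q + 9).choose 2 + 2 * (q + 5).choose 3 + 2 ≤
      (q + 9).choose 3 + (q + 3).choose 3 := by
    intro q
    induction q with
    | zero => decide
    | succ q ih =>
      have e1 : (q + 1 + 9).choose 3 = (q + 9).choose 2 + (q + 9).choose 3 :=
        Nat.choose_succ_succ' _ _
      have e2 : (q + 1 + 5).choose 3 = (q + 5).choose 2 + (q + 5).choose 3 :=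
        Nat.choose_succ_succ' _ _
      have e3 : (q + 1 + 3).choose 3 = (q + 3).choose 2 + (q + 3).choose 3 :=
        Nat.choose_succ_succ' _ _
      have e4 : (q + 1 + 9).choose 2 = (q + 9).choose 1 + (q + 9).choose 2 :=
        Nat.choose_succ_succ' _ _
      have := quad q
      omega
  have quartic : ∀ q : ℕ, (q + 9).choose 3 + 2 * (q + 5).choose 4 + 2 * (q + 5) + 1 ≤
      (q + 9).choose 4 + (q + 3).choose 4 := by
    intro q
    induction q with
    | zero => decide
    | succ q ih =>
      have e1 : (q + 1 + 9).choose 4 = (q + 9).choose 3 + (q + 9).choose 4 :=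
        Nat.choose_succ_succ' _ _
      have e2 : (q + 1 + 5).choose 4 = (q + 5).choose 3 + (q + 5).choose 4 :=
        Nat.choose_succ_succ' _ _
      have e3 : (q + 1 + 3).choose 4 = (q + 3).choose 3 + (q + 3).choose 4 :=
        Nat.choose_succ_succ' _ _
      have e4 : (q + 1 + 9).choose 3 = (q + 9).choose 2 + (q + 9).choose 3 :=
        Nat.choose_succ_succ' _ _
      have := cubic q
      omega
  -- Here `s = c + 4` and `r = q + c + 5`. Pascal's rule reduces `(r, s)` to `(r - 1, s)` and
  -- `(r, s - 1)`; the boundary cases are `s = 4`, which is `quartic`, and `r = s + 1`.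
  have main : ∀ c q : ℕ, (q + 2 * c + 9).choose (c + 3) + 2 * (q + c + 5).choose (c + 4) +
      2 * (q + c + 5) + 1 ≤ (q + 2 * c + 9).choose (c + 4) + (q + c + 3).choose (c + 4) := by
    intro c
    induction c with
    | zero => simpa using quartic
    | succ c ihc =>
      intro q
      induction q with
      | zero =>
        have i1 := ihc 1
        have a1 : 0 + 2 * (c + 1) + 9 = 2 * c + 10 + 1 := by ring
        have a2 : 0 + (c + 1) + 5 = c + 5 + 1 := by ring
        have a3 : 0 + (c + 1) + 3 = c + 4 := by ring
        have a4 : c + 1 + 3 = c + 3 + 1 := by ring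
        have a5 : c + 1 + 4 = c + 4 + 1 := by ring
        have b1 : 1 + 2 * c + 9 = 2 * c + 10 := by ring
        have b2 : 1 + c + 5 = c + 5 + 1 := by ring
        have b3 : 1 + c + 3 = c + 4 := by ring
        rw [b1, b2, b3, Nat.choose_self] at i1
        rw [a1, a2, a3, a4, a5, Nat.choose_succ_succ', Nat.choose_succ_succ' (2 * c + 10) (c + 4),
          Nat.choose_succ_self]
        have e1 : (c + 4 + 1 + 1).choose (c + 4 + 1) = c + 6 := Nat.choose_succ_self_right _
        have e1' : (c + 5 + 1).choose (c + 4 + 1) = c + 6 := e1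
        have e2 := add_two_le_choose (a := c + 5 + 1) (c := c + 4) (by omega) (by omega)
        have e3 := choose_le_choose_of_le_add (x := 2 * c + 10) (r := c + 6) (s := c + 5)
          (by omega) (by omega)
        have e4 : (2 * c + 10).choose (c + 4) = (2 * c + 10).choose (c + 6) :=
          Nat.choose_symm_of_eq_add (by ring)
        have e5 : (2 * c + 10).choose (c + 3 + 1) = (2 * c + 10).choose (c + 4) := rfl
        have e6 : (2 * c + 10).choose (c + 4 + 1) = (2 * c + 10).choose (c + 5) := rfl
        omega
      | succ q ihq =>
        have i1 := ihc (q + 2)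
        have a1 : q + 1 + 2 * (c + 1) + 9 = q + 2 * c + 11 + 1 := by ring
        have a2 : q + 1 + (c + 1) + 5 = q + c + 6 + 1 := by ring
        have a3 : q + 1 + (c + 1) + 3 = q + c + 4 + 1 := by ring
        have a4 : c + 1 + 3 = c + 3 + 1 := by ring
        have a5 : c + 1 + 4 = c + 4 + 1 := by ring
        have a6 : c + 4 = c + 3 + 1 := by ring
        have b1 : q + 2 + 2 * c + 9 = q + 2 * c + 11 := by ring
        have b2 : q + 2 + c + 5 = q + c + 6 + 1 := by ring
        have b3 : q + 2 + c + 3 = q + c + 4 + 1 := by ring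
        have d1 : q + 2 * (c + 1) + 9 = q + 2 * c + 11 := by ring
        have d2 : q + (c + 1) + 5 = q + c + 6 := by ring
        have d3 : q + (c + 1) + 3 = q + c + 4 := by ring
        rw [d1, d2, d3, a4, a5, a6] at ihq
        rw [b1, b2, b3, a6, Nat.choose_succ_succ' (q + c + 6), Nat.choose_succ_succ' (q + c + 4)]
          at i1
        rw [a1, a2, a3, a4, a5, a6, Nat.choose_succ_succ' (q + 2 * c + 11) (c + 3),
          Nat.choose_succ_succ' (q + 2 * c + 11) (c + 3 + 1), Nat.choose_succ_succ' (q + c + 6),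
          Nat.choose_succ_succ' (q + c + 4)]
        have f1 : (q + c + 6).choose (c + 4) = (q + c + 6).choose (c + 3 + 1) := rfl
        have f2 : (q + c + 6).choose (c + 4 + 1) = (q + c + 6).choose (c + 3 + 1 + 1) := rfl
        have f3 : (q + c + 4).choose (c + 4) = (q + c + 4).choose (c + 3 + 1) := rfl
        have f4 : (q + c + 4).choose (c + 4 + 1) = (q + c + 4).choose (c + 3 + 1 + 1) := rfl
        have := Nat.choose_le_choose (c + 3) (show q + c + 4 ≤ q + c + 6 by omega)
        omega
  obtain ⟨c, rfl⟩ : ∃ c, s = c + 4 := ⟨s - 4, by omega⟩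
  obtain ⟨q, rfl⟩ : ∃ q, r = q + c + 5 := ⟨r - c - 5, by omega⟩
  have := main c q
  have e1 : q + c + 5 + (c + 4) = q + 2 * c + 9 := by ring
  have e2 : c + 4 - 1 = c + 3 := rfl
  have e3 : q + c + 5 - 2 = q + c + 3 := rfl
  rw [deficit, e1, e2, e3]
  push_cast
  omega

/-! ### Cross-intersecting families -/

lemma shadowGain_choose {r s x : ℕ} (hsr : s ≤ r) (hx : r ≤ x) :
    ShadowGain r s (x.choose r) (x.choose s - x.choose r) := by
  refine ShadowGain.of_isInitSeg hsr fun 𝒞 hinit hc => ?_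
  have h1 := powersetCard_subset_of_isInitSeg hinit hc.ge
  have h2 : powersetCard s (range x) ⊆ down s 𝒞 := by
    intro t ht
    obtain ⟨ht1, ht2⟩ := mem_powersetCard.1 ht
    obtain ⟨u, htu, hu, huc⟩ := exists_subsuperset_card_eq (n := r) ht1 (by omega) (by simpa)
    exact mem_down.2 ⟨u, h1 (mem_powersetCard.2 ⟨hu, huc⟩), htu, ht2⟩
  have := card_le_card h2
  rw [card_powersetCard, card_range] at this
  omega

/-- The complements in `V` of the members of `X` have a shadow disjoint from every family that
cross-intersects `X`. -/
lemma ShadowGain.card_add_le {V : Finset ℕ} {X Y : Finset (Finset ℕ)} {v x y b : ℕ} {w : ℤ}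
    (hV : #V = v + x) (hX : X ⊆ powersetCard x V) (hY : Y ⊆ powersetCard y V)
    (hXY : ∀ A ∈ X, ∀ B ∈ Y, ¬ Disjoint A B) (h : ShadowGain v y b w) (hb : b ≤ #X) :
    (b : ℤ) + w + #Y ≤ (#V).choose y := by
  have hsub : ∀ A ∈ X, A ⊆ V := fun A hA => (mem_powersetCard.1 (hX hA)).1
  have hcard : #(X.image fun A => V \ A) = #X := by
    refine card_image_of_injOn fun A hA B hB hAB => ?_
    rw [← Finset.sdiff_sdiff_eq_self (hsub A hA), ← Finset.sdiff_sdiff_eq_self (hsub B hB)]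
    exact congrArg (V \ ·) hAB
  have hsized : ((X.image fun A => V \ A : Finset (Finset ℕ)) : Set (Finset ℕ)).Sized v := by
    intro C hC
    obtain ⟨A, hA, rfl⟩ := mem_image.1 (mem_coe.1 hC)
    rw [card_sdiff_of_subset (hsub A hA), (mem_powersetCard.1 (hX hA)).2]
    omega
  have h1 := h.le_card_down hsized (by rwa [hcard])
  have hdisj : Disjoint (down y (X.image fun A => V \ A)) Y := by
    rw [disjoint_left]
    intro t ht htY
    obtain ⟨C, hC, htC, -⟩ := mem_down.1 ht
    obtain ⟨A, hA, rfl⟩ := mem_image.1 hC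
    exact hXY A hA t htY (disjoint_sdiff.mono_right htC)
  have hsub2 : down y (X.image fun A => V \ A) ∪ Y ⊆ powersetCard y V := by
    refine union_subset (fun t ht => ?_) hY
    obtain ⟨C, hC, htC, htc⟩ := mem_down.1 ht
    obtain ⟨A, hA, rfl⟩ := mem_image.1 hC
    exact mem_powersetCard.2 ⟨htC.trans sdiff_subset, htc⟩
  have h2 := card_le_card hsub2
  rw [card_union_of_disjoint hdisj, card_powersetCard] at h2
  omega

/-- Two cross-intersecting families of `s`-sets cannot both be larger than a star. -/
lemma card_le_or_card_le {V : Finset ℕ} {X Y : Finset (Finset ℕ)} {r s : ℕ} (hs : 1 ≤ s)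
    (hsr : s ≤ r) (hV : #V = r + s) (hX : X ⊆ powersetCard s V) (hY : Y ⊆ powersetCard s V)
    (hXY : ∀ A ∈ X, ∀ B ∈ Y, ¬ Disjoint A B) :
    #X ≤ (r + s - 1).choose (s - 1) ∨ #Y ≤ (r + s - 1).choose (s - 1) := by
  obtain ⟨s, rfl⟩ : ∃ q, s = q + 1 := ⟨s - 1, by omega⟩
  have e : (r + (s + 1) - 1).choose r = (r + (s + 1) - 1).choose (s + 1 - 1) :=
    Nat.choose_symm_of_eq_add (by omega)
  by_contra! h
  have h1 := (shadowGain_choose (x := r + (s + 1) - 1) hsr (by omega)).card_add_le hV hX hY hXY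
    (by omega)
  rw [hV] at h1
  have h2 := Nat.choose_succ_succ' (r + s) s
  simp only [← add_assoc, Nat.add_sub_cancel] at *
  omega

/-- In a large cross-intersecting pair of families of `s`-sets and of `(s + 1)`-sets, either there
are few `(s + 1)`-sets or the `s`-sets barely outnumber a star. -/
lemma card_le_or_card_le_of_le_add {V : Finset ℕ} {X Y : Finset (Finset ℕ)} {r s : ℕ}
    (hs : 4 ≤ s) (hsr : s + 1 ≤ r) (hV : #V = r + s + 1) (hX : X ⊆ powersetCard s V)
    (hY : Y ⊆ powersetCard (s + 1) V) (hXY : ∀ A ∈ X, ∀ B ∈ Y, ¬ Disjoint A B)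
    (hcard : ((r + s + 1).choose s : ℤ) - deficit r s ≤ #X + #Y) :
    #Y ≤ r + 1 ∨ #X ≤ (r + s).choose (s - 1) + r + 1 := by
  by_contra! h
  obtain ⟨h1, h2⟩ := h
  have hYX : ∀ A ∈ Y, ∀ B ∈ X, ¬ Disjoint A B := fun A hA B hB hAB => hXY B hB A hA hAB.symm
  -- For small `Y` the complements of `Y` are in the middle range. For large `Y` there are few
  -- `s`-sets, and the excess of `X` over a star is in the middle range.
  rcases le_total #Y ((r + s - 1).choose r) with h3 | h3
  · have := (shadowGain_of_add_two_le hs hsr (by omega) h3).card_add_le (x := s + 1)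
      (by omega) hY hX hYX le_rfl
    rw [hV] at this
    omega
  · have e0 := (shadowGain_choose (r := r) (s := s) (x := r + s - 1) (by omega)
      (by omega)).card_add_le (x := s + 1) (by omega) hY hX hYX h3
    obtain ⟨s, rfl⟩ : ∃ q, s = q + 1 := ⟨s - 1, by omega⟩
    rw [hV] at e0
    simp only [← add_assoc, Nat.add_sub_cancel] at *
    have e1 := Nat.choose_succ_succ' (r + s + 1) s
    have e2 := Nat.choose_succ_succ' (r + s) s
    have e3 : (r + s).choose r = (r + s).choose s := Nat.choose_symm_add
    have e4 : (r + s + 1).choose (r + 1) = (r + s + 1).choose s :=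
      Nat.choose_symm_of_eq_add (by omega)
    have e5 : (r + s + 1).choose r = (r + s + 1).choose (s + 1) :=
      Nat.choose_symm_of_eq_add (by omega)
    obtain ⟨a, ha⟩ : ∃ a, #X = (r + s + 1).choose (r + 1) + a :=
      ⟨#X - (r + s + 1).choose (r + 1), by omega⟩
    have g := (shadowGain_of_add_two_le (b := a) hs hsr (by omega)
      (by simp only [← add_assoc, Nat.add_sub_cancel]; omega)).succ (x := r + s + 1) (by omega)
      (by omega) (by omega)
    have := g.card_add_le (x := s + 1) (by omega) hX hY hXY ha.ge
    rw [hV, Nat.choose_succ_succ' (r + s + 1) (s + 1)] at this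
    push_cast at this
    omega

/-- An intersecting uniform family is no larger than its shadow: the inclusion vectors of its
members over the shadow are linearly independent. -/
lemma card_le_card_down_of_intersecting {k : ℕ} {ℬ : Finset (Finset ℕ)}
    (hk : (ℬ : Set (Finset ℕ)).Sized (k + 1)) (hint : (ℬ : Set (Finset ℕ)).Intersecting) :
    #ℬ ≤ #(down k ℬ) := by
  classical
  let φ : (ℬ → ℚ) →ₗ[ℚ] (down k ℬ → ℚ) :=
    { toFun := fun c S => ∑ A : ℬ, if (S : Finset ℕ) ⊆ A then c A else 0
      map_add' := fun c d => by
        ext S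
        simp only [Pi.add_apply, ← sum_add_distrib]
        exact sum_congr rfl fun A _ => by split_ifs <;> simp
      map_smul' := fun a c => by
        ext S
        simp only [Pi.smul_apply, smul_eq_mul, mul_sum, RingHom.id_apply]
        exact sum_congr rfl fun A _ => by split_ifs <;> simp }
  have hφ : Function.Injective φ := by
    rw [← LinearMap.ker_eq_bot, LinearMap.ker_eq_bot']
    intro c hc
    -- `f U = 0` for all `U` with at most `k` elements, by downward induction on the size of `U`
    let f : Finset ℕ → ℚ := fun U => ∑ A : ℬ, if U ⊆ (A : Finset ℕ) then c A else 0
    have hf : ∀ d U, #U + d = k → f U = 0 := by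
      intro d
      induction d with
      | zero =>
        intro U hU
        by_cases h : U ∈ down k ℬ
        · exact congrFun hc ⟨U, h⟩
        · refine sum_eq_zero fun A _ => if_neg fun hUA => h ?_
          exact mem_down.2 ⟨A, A.2, hUA, by omega⟩
      | succ d ih =>
        intro U hU
        have h0 : ∑ x ∈ ℬ.biUnion id \ U, f (insert x U) = 0 := by
          refine sum_eq_zero fun x hx => ih _ ?_
          rw [card_insert_of_notMem (mem_sdiff.1 hx).2]
          omega
        rw [sum_comm] at h0
        have h1 : ∀ A : ℬ, (∑ x ∈ ℬ.biUnion id \ U,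
            if insert x U ⊆ (A : Finset ℕ) then c A else 0) =
            (d + 2 : ℚ) * (if U ⊆ (A : Finset ℕ) then c A else 0) := by
          intro A
          split_ifs with hUA
          · rw [← sum_filter, sum_const, nsmul_eq_mul]
            congr 1
            have : (ℬ.biUnion id \ U).filter (fun x => insert x U ⊆ (A : Finset ℕ)) =
                (A : Finset ℕ) \ U := by
              ext x
              simp only [mem_filter, mem_sdiff, insert_subset_iff, mem_biUnion, id]
              constructor
              · rintro ⟨⟨-, h2⟩, h3, -⟩
                exact ⟨h3, h2⟩
              · rintro ⟨h2, h3⟩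
                exact ⟨⟨⟨A, A.2, h2⟩, h3⟩, h2, hUA⟩
            rw [this, card_sdiff_of_subset hUA, hk A.2]
            have : k + 1 - #U = d + 2 := by omega
            rw [this]
            push_cast
            ring
          · rw [mul_zero]
            refine sum_eq_zero fun x _ => if_neg fun h => hUA ?_
            exact (subset_insert x U).trans h
        rw [sum_congr rfl fun A _ => h1 A, ← mul_sum] at h0
        refine (mul_eq_zero.1 h0).resolve_left ?_
        positivity
    ext B
    -- alternating sums over the subsets of the nonempty sets `B ∩ A` vanish, so only `U = B` is left
    have h2 : ∑ U ∈ (B : Finset ℕ).powerset, (-1 : ℚ) ^ #U * f U = 0 := by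
      simp only [f, mul_sum]
      rw [sum_comm]
      refine sum_eq_zero fun A _ => ?_
      have h3 : ∑ U ∈ (B : Finset ℕ).powerset,
          (-1 : ℚ) ^ #U * (if U ⊆ (A : Finset ℕ) then c A else 0) =
          (∑ U ∈ ((B : Finset ℕ) ∩ A).powerset, (-1 : ℚ) ^ #U) * c A := by
        rw [sum_mul]
        have : ((B : Finset ℕ) ∩ A).powerset =
            (B : Finset ℕ).powerset.filter fun U => U ⊆ (A : Finset ℕ) := by
          ext U
          rw [mem_powerset, subset_inter_iff, mem_filter, mem_powerset]
        rw [this, sum_filter]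
        exact sum_congr rfl fun U _ => by split_ifs <;> simp
      rw [h3]
      have hne : ((B : Finset ℕ) ∩ A).Nonempty := not_disjoint_iff_nonempty_inter.1 (hint B.2 A.2)
      have h4 := sum_powerset_neg_one_pow_card_of_nonempty hne
      have h5 : ∑ U ∈ ((B : Finset ℕ) ∩ A).powerset, (-1 : ℚ) ^ #U = 0 := by
        exact_mod_cast congrArg (Int.cast : ℤ → ℚ) h4
      rw [h5, zero_mul]
    rw [sum_eq_single (B : Finset ℕ)] at h2
    · have h6 : f B = c B := by
        simp only [f]
        rw [sum_eq_single B]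
        · simp
        · intro A _ hAB
          refine if_neg fun h => hAB ?_
          exact Subtype.ext (eq_of_subset_of_card_le h (by rw [hk A.2, hk B.2])).symm
        · simp
      rw [h6] at h2
      simpa using h2
    · intro U hU hUB
      have hlt := card_lt_card ((mem_powerset.1 hU).ssubset_of_ne hUB)
      rw [hk B.2] at hlt
      rw [hf (k - #U) U (by omega), mul_zero]
    · simp
  have := LinearMap.finrank_le_finrank_of_injective hφ
  simpa using this

/-! ### Links, shifting and the existence of a centre -/

/-- The members of `F` through `i`, with `i` removed. -/
def link (i : ℕ) (F : Finset (Finset ℕ)) : Finset (Finset ℕ) :=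
  (F.filter fun A => i ∈ A).image fun A => A.erase i

lemma mem_link {i : ℕ} {F : Finset (Finset ℕ)} {T : Finset ℕ} :
    T ∈ link i F ↔ i ∉ T ∧ insert i T ∈ F := by
  simp only [link, mem_image, mem_filter]
  constructor
  · rintro ⟨A, ⟨hA, hi⟩, rfl⟩
    exact ⟨notMem_erase _ _, by rwa [insert_erase hi]⟩
  · rintro ⟨hi, hT⟩
    exact ⟨_, ⟨hT, mem_insert_self _ _⟩, erase_insert hi⟩

lemma card_link (i : ℕ) (F : Finset (Finset ℕ)) : #(link i F) = #(F.filter fun A => i ∈ A) := by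
  refine card_image_of_injOn fun A hA B hB hAB => ?_
  have hA := (mem_filter.1 (mem_coe.1 hA)).2
  have hB := (mem_filter.1 (mem_coe.1 hB)).2
  rw [← insert_erase hA, ← insert_erase hB]
  exact congrArg (insert i) hAB

lemma card_link_add_card_avoiding (i : ℕ) (F : Finset (Finset ℕ)) :
    #(link i F) + #(avoiding i F) = #F := by
  rw [card_link]
  exact card_filter_add_card_filter_not _

lemma mem_avoiding {i : ℕ} {F : Finset (Finset ℕ)} {A : Finset ℕ} :
    A ∈ avoiding i F ↔ A ∈ F ∧ i ∉ A := mem_filter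

lemma mem_kSets {n k : ℕ} {A : Finset ℕ} : A ∈ kSets n k ↔ A ⊆ Icc 1 n ∧ #A = k :=
  mem_powersetCard

lemma link_subset {V : Finset ℕ} {i k : ℕ} {F : Finset (Finset ℕ)}
    (hF : F ⊆ powersetCard (k + 1) V) : link i F ⊆ powersetCard k (V.erase i) := by
  intro T hT
  obtain ⟨hi, hT⟩ := mem_link.1 hT
  obtain ⟨h1, h2⟩ := mem_powersetCard.1 (hF hT)
  rw [card_insert_of_notMem hi] at h2
  exact mem_powersetCard.2
    ⟨subset_erase.2 ⟨(subset_insert _ _).trans h1, hi⟩, by omega⟩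

lemma avoiding_subset {V : Finset ℕ} {i k : ℕ} {F : Finset (Finset ℕ)}
    (hF : F ⊆ powersetCard k V) : avoiding i F ⊆ powersetCard k (V.erase i) := by
  intro A hA
  obtain ⟨hA, hi⟩ := mem_avoiding.1 hA
  obtain ⟨h1, h2⟩ := mem_powersetCard.1 (hF hA)
  exact mem_powersetCard.2 ⟨subset_erase.2 ⟨h1, hi⟩, h2⟩

lemma not_disjoint_of_mem_link {i : ℕ} {F : Finset (Finset ℕ)}
    (hint : (F : Set (Finset ℕ)).Intersecting) {A B : Finset ℕ} (hA : A ∈ link i F)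
    (hB : B ∈ avoiding i F) : ¬ Disjoint A B := by
  obtain ⟨-, hA⟩ := mem_link.1 hA
  obtain ⟨hB, hi⟩ := mem_avoiding.1 hB
  intro h
  exact hint hA hB (disjoint_insert_left.2 ⟨hi, h⟩)

/-- Every point of a large intersecting family is either a centre, avoided by at most `r + 1`
members, or has degree little more than the number of sets through two points. -/
lemma card_avoiding_le_or_card_link_le {r s i : ℕ} (hs : 4 ≤ s) (hsr : s + 1 ≤ r)
    {F : Finset (Finset ℕ)} (hF : F ⊆ kSets (r + s + 2) (s + 1))
    (hint : (F : Set (Finset ℕ)).Intersecting)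
    (hcard : ((r + s + 1).choose s : ℤ) - deficit r s ≤ #F) (hi : i ∈ Icc 1 (r + s + 2)) :
    #(avoiding i F) ≤ r + 1 ∨ #(link i F) ≤ (r + s).choose (s - 1) + r + 1 := by
  refine card_le_or_card_le_of_le_add hs hsr (V := (Icc 1 (r + s + 2)).erase i) ?_
    (link_subset hF) (avoiding_subset hF) (fun A hA B hB => not_disjoint_of_mem_link hint hA hB) ?_
  · rw [card_erase_of_mem hi, Nat.card_Icc]
    omega
  · have := card_link_add_card_avoiding i F
    omega

lemma compress_eq {p j : ℕ} {A : Finset ℕ} (hp : p ∉ A) (hj : j ∈ A) (hpj : p ≠ j) :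
    UV.compress {p} {j} A = insert p (A.erase j) := by
  rw [UV.compress, if_pos ⟨by simpa using hp, by simpa using hj⟩]
  ext x
  simp only [sup_eq_union, mem_sdiff, mem_union, mem_singleton, mem_insert, mem_erase]
  constructor
  · rintro ⟨h1 | h1, h2⟩
    · exact Or.inr ⟨h2, h1⟩
    · exact Or.inl h1
  · rintro (h | h)
    · subst h
      exact ⟨Or.inr rfl, hpj⟩
    · exact ⟨Or.inl h.2, h.1⟩

lemma compress_eq_self {p j : ℕ} {A : Finset ℕ} (h : p ∈ A ∨ j ∉ A) :
    UV.compress {p} {j} A = A := by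
  rw [UV.compress, if_neg]
  rintro ⟨h1, h2⟩
  rw [disjoint_singleton_left] at h1
  rcases h with h | h
  · exact h1 h
  · exact h (h2 (mem_singleton_self j))

/-- A member of the shifted family is an old member fixed in place, or an old member through `j`
that has been moved to a set through `p`. -/
lemma mem_compression_cases {p j : ℕ} (hpj : p ≠ j) {F : Finset (Finset ℕ)} {A : Finset ℕ}
    (hA : A ∈ UV.compression {p} {j} F) :
    (A ∈ F ∧ (p ∈ A ∨ j ∉ A ∨ insert p (A.erase j) ∈ F)) ∨
      ∃ B ∈ F, p ∉ B ∧ j ∈ B ∧ A = insert p (B.erase j) := by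
  rcases UV.mem_compression.1 hA with ⟨h1, h2⟩ | ⟨h1, B, hB, hBA⟩
  · left
    refine ⟨h1, ?_⟩
    by_cases hp : p ∈ A
    · exact Or.inl hp
    by_cases hj : j ∈ A
    · rw [compress_eq hp hj hpj] at h2
      exact Or.inr (Or.inr h2)
    · exact Or.inr (Or.inl hj)
  · right
    by_cases h : p ∈ B ∨ j ∉ B
    · rw [compress_eq_self h] at hBA
      exact absurd (hBA ▸ hB) h1
    · push Not at h
      exact ⟨B, hB, h.1, h.2, by rw [← hBA, compress_eq h.1 h.2 hpj]⟩

lemma intersecting_compression {p j : ℕ} (hpj : p ≠ j) {F : Finset (Finset ℕ)}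
    (hint : (F : Set (Finset ℕ)).Intersecting) :
    (UV.compression {p} {j} F : Set (Finset ℕ)).Intersecting := by
  have key : ∀ A B : Finset ℕ, A ∈ F → (p ∈ A ∨ j ∉ A ∨ insert p (A.erase j) ∈ F) → B ∈ F →
      p ∉ B → j ∈ B → ¬ Disjoint A (insert p (B.erase j)) := by
    intro A B hA hA' hB hpB hjB hdisj
    rw [disjoint_insert_right] at hdisj
    obtain ⟨hpA, hdisj⟩ := hdisj
    rcases hA' with h | h | h
    · exact hpA h
    · refine hint hA hB (disjoint_left.2 fun x hxA hxB => ?_)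
      exact disjoint_left.1 hdisj hxA (mem_erase.2 ⟨fun hx => h (hx ▸ hxA), hxB⟩)
    · refine hint h hB (disjoint_left.2 fun x hxA hxB => ?_)
      rcases mem_insert.1 hxA with rfl | hxA
      · exact hpB hxB
      · obtain ⟨hxj, hxA⟩ := mem_erase.1 hxA
        exact disjoint_left.1 hdisj hxA (mem_erase.2 ⟨hxj, hxB⟩)
  intro A hA B hB
  rcases mem_compression_cases hpj (mem_coe.1 hA) with ⟨hA1, hA'⟩ | ⟨A, hA1, hpA, hjA, rfl⟩
  · rcases mem_compression_cases hpj (mem_coe.1 hB) with ⟨hB1, hB'⟩ | ⟨B, hB1, hpB, hjB, rfl⟩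
    · exact hint hA1 hB1
    · exact key A B hA1 hA' hB1 hpB hjB
  · rcases mem_compression_cases hpj (mem_coe.1 hB) with ⟨hB1, hB'⟩ | ⟨B, hB1, hpB, hjB, rfl⟩
    · exact fun h => key B A hB1 hB' hA1 hpA hjA h.symm
    · exact not_disjoint_iff.2 ⟨p, mem_insert_self _ _, mem_insert_self _ _⟩

lemma compression_subset_kSets {n k p j : ℕ} (hp : p ∈ Icc 1 n) (hpj : p ≠ j)
    {F : Finset (Finset ℕ)} (hF : F ⊆ kSets n k) : UV.compression {p} {j} F ⊆ kSets n k := by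
  intro A hA
  rcases mem_compression_cases hpj hA with ⟨hA, -⟩ | ⟨B, hB, hpB, hjB, rfl⟩
  · exact hF hA
  · obtain ⟨h1, h2⟩ := mem_kSets.1 (hF hB)
    refine mem_kSets.2 ⟨insert_subset hp ((erase_subset _ _).trans h1), ?_⟩
    rw [card_insert_of_notMem fun h => hpB (mem_of_mem_erase h), card_erase_of_mem hjB, h2]
    have := card_pos.2 ⟨j, hjB⟩
    omega

/-- A shift towards `p` does not increase the degree of any other point. -/
lemma card_avoiding_le_compression {p j c : ℕ} (hpj : p ≠ j) (hc : c ≠ p)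
    (F : Finset (Finset ℕ)) :
    #(avoiding c F) ≤ #(avoiding c (UV.compression {p} {j} F)) := by
  refine card_le_card_of_injOn
    (fun A => if UV.compress {p} {j} A ∈ F then A else UV.compress {p} {j} A) ?_ ?_
  · intro A hA
    obtain ⟨hA, hcA⟩ := mem_avoiding.1 (mem_coe.1 hA)
    simp only [mem_coe, mem_avoiding]
    split_ifs with h
    · exact ⟨UV.mem_compression.2 (Or.inl ⟨hA, h⟩), hcA⟩
    · refine ⟨UV.mem_compression.2 (Or.inr ⟨h, A, hA, rfl⟩), fun hcc => ?_⟩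
      by_cases hA' : p ∈ A ∨ j ∉ A
      · rw [compress_eq_self hA'] at hcc
        exact hcA hcc
      · push Not at hA'
        rw [compress_eq hA'.1 hA'.2 hpj, mem_insert] at hcc
        rcases hcc with hcc | hcc
        · exact hc hcc
        · exact hcA (mem_of_mem_erase hcc)
  · intro A hA B hB hAB
    have hA := (mem_avoiding.1 (mem_coe.1 hA)).1
    have hB := (mem_avoiding.1 (mem_coe.1 hB)).1
    simp only at hAB
    split_ifs at hAB with h1 h2 h2
    · exact hAB
    · exact absurd (hAB ▸ hA) h2
    · exact absurd (hAB ▸ hB) h1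
    · exact UV.compress_injOn (s := F) (mem_coe.2 (mem_filter.2 ⟨hA, h1⟩))
        (mem_coe.2 (mem_filter.2 ⟨hB, h2⟩)) hAB

/-- A shift towards `p` that moves some set increases the degree of `p`. -/
lemma card_avoiding_compression_lt {p j : ℕ} (hpj : p ≠ j) {F : Finset (Finset ℕ)}
    {A : Finset ℕ} (hA : A ∈ F) (hpA : p ∉ A) (hjA : j ∈ A) (hA' : insert p (A.erase j) ∉ F) :
    #(avoiding p (UV.compression {p} {j} F)) < #(avoiding p F) := by
  refine card_lt_card (ssubset_iff_of_subset ?_ |>.2 ⟨A, mem_avoiding.2 ⟨hA, hpA⟩, ?_⟩)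
  · intro B hB
    obtain ⟨hB, hpB⟩ := mem_avoiding.1 hB
    rcases mem_compression_cases hpj hB with ⟨hB, -⟩ | ⟨C, -, -, -, rfl⟩
    · exact mem_avoiding.2 ⟨hB, hpB⟩
    · exact absurd (mem_insert_self _ _) hpB
  · intro h
    rcases UV.mem_compression.1 (mem_avoiding.1 h).1 with ⟨-, h⟩ | ⟨h, -⟩
    · rw [compress_eq hpA hjA hpj] at h
      exact hA' h
    · exact h hA

/-- The members through `p` but not `j` and those through `j` but not `p` form a cross-intersecting
pair, one side of which is at most a star. -/
lemma exists_card_avoiding_le {r s p j : ℕ} (hs : 4 ≤ s) (hsr : s + 1 ≤ r)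
    {F : Finset (Finset ℕ)} (hF : F ⊆ kSets (r + s + 2) (s + 1))
    (hint : (F : Set (Finset ℕ)).Intersecting) (hp : p ∈ Icc 1 (r + s + 2))
    (hj : j ∈ Icc 1 (r + s + 2)) (hpj : p ≠ j) :
    #(avoiding p F) ≤ (r + s - 1).choose (s - 1) + #(avoiding p (avoiding j F)) ∨
      #(avoiding j F) ≤ (r + s - 1).choose (s - 1) + #(avoiding p (avoiding j F)) := by
  have hV : #(((Icc 1 (r + s + 2)).erase p).erase j) = r + s := by
    rw [card_erase_of_mem (mem_erase.2 ⟨hpj.symm, hj⟩), card_erase_of_mem hp, Nat.card_Icc]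
    omega
  have hcomm : avoiding j (avoiding p F) = avoiding p (avoiding j F) := filter_comm _ _ _
  have h1 : link j (avoiding p F) ⊆ powersetCard s (((Icc 1 (r + s + 2)).erase p).erase j) :=
    link_subset (avoiding_subset hF)
  have h2 : link p (avoiding j F) ⊆ powersetCard s (((Icc 1 (r + s + 2)).erase p).erase j) := by
    rw [erase_right_comm]
    exact link_subset (avoiding_subset hF)
  have e1 := card_link_add_card_avoiding j (avoiding p F)
  have e2 := card_link_add_card_avoiding p (avoiding j F)
  rw [hcomm] at e1
  have hcross : ∀ A ∈ link j (avoiding p F), ∀ B ∈ link p (avoiding j F), ¬ Disjoint A B := by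
    intro A hA B hB hAB
    obtain ⟨hjA, hA⟩ := mem_link.1 hA
    obtain ⟨hpB, hB⟩ := mem_link.1 hB
    obtain ⟨hA, hpA⟩ := mem_avoiding.1 hA
    obtain ⟨hB, hjB⟩ := mem_avoiding.1 hB
    refine hint hA hB ?_
    rw [disjoint_insert_left, disjoint_insert_right]
    exact ⟨hjB, fun h => hpA (mem_insert_of_mem h), hAB⟩
  rcases card_le_or_card_le (by omega) (by omega) hV h1 h2 hcross with h | h
  · left; omega
  · right; omega

/-- A large intersecting family has a centre. -/
lemma exists_card_avoiding_le_of_le_card {r s : ℕ} (hs : 4 ≤ s) (hsr : s + 1 ≤ r)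
    {F : Finset (Finset ℕ)} (hF : F ⊆ kSets (r + s + 2) (s + 1))
    (hint : (F : Set (Finset ℕ)).Intersecting)
    (hcard : ((r + s + 1).choose s : ℤ) - deficit r s ≤ #F) :
    ∃ i ∈ Icc 1 (r + s + 2), #(avoiding i F) ≤ r + 1 := by
  have hnum := choose_add_deficit_le hs hsr
  have hpascal : (r + s + 1).choose s = (r + s).choose (s - 1) + (r + s).choose s := by
    obtain ⟨s, rfl⟩ : ∃ q, s = q + 1 := ⟨s - 1, by omega⟩
    exact Nat.choose_succ_succ' _ _
  have hmono : (r + s - 1).choose (s - 1) ≤ (r + s).choose (s - 1) :=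
    Nat.choose_le_choose _ (by omega)
  have hone : 1 ∈ Icc 1 (r + s + 2) := by simp
  -- Shifting towards `1` strictly decreases the number of members that avoid `1`.
  induction hm : #(avoiding 1 F) using Nat.strong_induction_on generalizing F with
  | _ m ih =>
  by_contra! hno
  have hdeg : ∀ i ∈ Icc 1 (r + s + 2), #(link i F) ≤ (r + s).choose (s - 1) + r + 1 := fun i hi =>
    (card_avoiding_le_or_card_link_le hs hsr hF hint hcard hi).resolve_left
      (not_le.2 (hno i hi))
  by_cases hst : ∀ A ∈ F, 1 ∉ A → ∀ j ∈ A, insert 1 (A.erase j) ∈ F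
  -- If `F` is stable under all shifts towards `1`, the shadow of `avoiding 1 F` is in the link.
  · have h1 : down s (avoiding 1 F) ⊆ link 1 F := by
      intro T hT
      obtain ⟨A, hA, hTA, hTc⟩ := mem_down.1 hT
      obtain ⟨hA, h1A⟩ := mem_avoiding.1 hA
      have hAc := (mem_kSets.1 (hF hA)).2
      obtain ⟨j, hj⟩ := card_eq_one.1 (show #(A \ T) = 1 by
        rw [card_sdiff_of_subset hTA]; omega)
      have hjA : j ∈ A \ T := by rw [hj]; exact mem_singleton_self j
      have hT' : T = A.erase j := by
        rw [← sdiff_singleton_eq_erase, ← hj, Finset.sdiff_sdiff_eq_self hTA]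
      rw [mem_link, hT']
      exact ⟨fun h => h1A (mem_of_mem_erase h), hst A hA h1A j (mem_sdiff.1 hjA).1⟩
    have h2 := card_le_card_down_of_intersecting (k := s) (ℬ := avoiding 1 F)
      (fun A hA => (mem_kSets.1 (hF (mem_avoiding.1 (mem_coe.1 hA)).1)).2)
      (hint.mono fun A hA => mem_coe.2 (mem_avoiding.1 (mem_coe.1 hA)).1)
    have h3 := card_le_card h1
    have h4 := hdeg 1 hone
    have h5 := card_link_add_card_avoiding 1 F
    omega
  · push Not at hst
    obtain ⟨A, hA, h1A, j, hjA, hA'⟩ := hst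
    have hj1 : 1 ≠ j := fun h => h1A (h ▸ hjA)
    have hj : j ∈ Icc 1 (r + s + 2) := (mem_kSets.1 (hF hA)).1 hjA
    obtain ⟨c, hc, hcc⟩ := ih _ (hm ▸ card_avoiding_compression_lt hj1 hA h1A hjA hA')
      (compression_subset_kSets hone hj1 hF) (intersecting_compression hj1 hint)
      (by rwa [UV.card_compression]) rfl
    -- the shifted family has a centre `c`, which must be `1`
    have hc1 : c = 1 := by
      by_contra hc1
      have := card_avoiding_le_compression hj1 hc1 F
      have := hno c hc
      omega
    subst hc1
    have hR : avoiding 1 (avoiding j F) ⊆ avoiding 1 (UV.compression {1} {j} F) := by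
      intro B hB
      obtain ⟨hB, h1B⟩ := mem_avoiding.1 hB
      obtain ⟨hB, hjB⟩ := mem_avoiding.1 hB
      exact mem_avoiding.2 ⟨UV.mem_compression.2
        (Or.inl ⟨hB, by rwa [compress_eq_self (Or.inr hjB)]⟩), h1B⟩
    have h1 := card_le_card hR
    have h2 := card_link_add_card_avoiding 1 F
    have h3 := card_link_add_card_avoiding j F
    have h4 := hdeg 1 hone
    have h5 := hdeg j hj
    rcases exists_card_avoiding_le hs hsr hF hint hone hj hj1 with h | h <;> omega

/-! ### Families with few members avoiding `1` -/

/-- The members of `powersetCard s V` disjoint from `B` or from `C`. -/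
def missing (s : ℕ) (V B C : Finset ℕ) : Finset (Finset ℕ) :=
  powersetCard s (V \ B) ∪ powersetCard s (V \ C)

lemma mem_missing {s : ℕ} {V B C T : Finset ℕ} :
    T ∈ missing s V B C ↔ T ∈ powersetCard s V ∧ (Disjoint T B ∨ Disjoint T C) := by
  simp only [missing, mem_union, mem_powersetCard, subset_sdiff]
  tauto

lemma card_missing {r s : ℕ} {V B C : Finset ℕ} (hV : #V = r + s + 1) (hB : B ⊆ V) (hC : C ⊆ V)
    (hBc : #B = s + 1) (hCc : #C = s + 1) :
    #(missing s V B C) + (r - #(B \ C)).choose s = 2 * r.choose s := by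
  have h := card_union_add_card_inter (powersetCard s (V \ B)) (powersetCard s (V \ C))
  have hinter : powersetCard s (V \ B) ∩ powersetCard s (V \ C) = powersetCard s (V \ (B ∪ C)) := by
    ext T
    simp only [mem_inter, mem_powersetCard, subset_sdiff, disjoint_union_right]
    tauto
  have h1 : #(V \ B) = r := by rw [card_sdiff_of_subset hB]; omega
  have h2 : #(V \ C) = r := by rw [card_sdiff_of_subset hC]; omega
  have h3 : #(V \ (B ∪ C)) = r - #(B \ C) := by
    rw [card_sdiff_of_subset (union_subset hB hC), ← card_sdiff_add_card B C]
    omega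
  rw [hinter, card_powersetCard, card_powersetCard, card_powersetCard, h1, h2, h3] at h
  rw [missing]
  omega

lemma choose_le_card_filter {W Y : Finset ℕ} {s : ℕ} (hY : Y ⊆ W) (hs : #Y ≤ s) :
    (#W - #Y).choose (s - #Y) ≤ #((powersetCard s W).filter fun T => Y ⊆ T) := by
  rw [← card_sdiff_of_subset hY, ← card_powersetCard]
  refine card_le_card_of_injOn (fun U => U ∪ Y) ?_ ?_
  · intro U hU
    obtain ⟨h1, h2⟩ := mem_powersetCard.1 (mem_coe.1 hU)
    obtain ⟨h3, h4⟩ := subset_sdiff.1 h1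
    refine mem_coe.2 (mem_filter.2 ⟨mem_powersetCard.2 ⟨union_subset h3 hY, ?_⟩,
      subset_union_right⟩)
    rw [card_union_of_disjoint h4]
    omega
  · intro U hU U' hU' h
    have h1 := (subset_sdiff.1 (mem_powersetCard.1 (mem_coe.1 hU)).1).2
    have h2 := (subset_sdiff.1 (mem_powersetCard.1 (mem_coe.1 hU')).1).2
    rw [← union_sdiff_cancel_right h1, ← union_sdiff_cancel_right h2]
    exact congrArg (· \ Y) h

/-- Sets disjoint from a third member `D` that contain a transversal `Y ⊆ V \ D` of `B` and `C`
are not yet counted by `missing s V B C`. -/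
lemma card_link_add_le {r s : ℕ} {V B C D Y : Finset ℕ} {F : Finset (Finset ℕ)}
    (hV : #V = r + s + 1) (hlink : link 1 F ⊆ powersetCard s V)
    (havoid : avoiding 1 F ⊆ powersetCard (s + 1) V)
    (hint : (F : Set (Finset ℕ)).Intersecting) (hB : B ∈ avoiding 1 F) (hC : C ∈ avoiding 1 F)
    (hD : D ∈ avoiding 1 F) (hY : Y ⊆ V \ D) (hs : #Y ≤ s) (hYB : ¬ Disjoint Y B)
    (hYC : ¬ Disjoint Y C) :
    #(link 1 F) + 2 * r.choose s + (r - #Y).choose (s - #Y) ≤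
      (r + s + 1).choose s + (r - #(B \ C)).choose s := by
  obtain ⟨hBV, hBc⟩ := mem_powersetCard.1 (havoid hB)
  obtain ⟨hCV, hCc⟩ := mem_powersetCard.1 (havoid hC)
  obtain ⟨hDV, hDc⟩ := mem_powersetCard.1 (havoid hD)
  have h1 := card_missing hV hBV hCV hBc hCc
  have h2 := choose_le_card_filter hY hs
  have hW : #(V \ D) = r := by rw [card_sdiff_of_subset hDV]; omega
  rw [hW] at h2
  set E := (powersetCard s (V \ D)).filter fun T => Y ⊆ T
  have hdisj : Disjoint (missing s V B C) E := by
    rw [disjoint_left]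
    intro T hT hT'
    have hYT := (mem_filter.1 hT').2
    rcases (mem_missing.1 hT).2 with h | h
    · exact hYB (h.mono_left hYT)
    · exact hYC (h.mono_left hYT)
  have hdisj' : Disjoint (link 1 F) (missing s V B C ∪ E) := by
    rw [disjoint_left]
    intro T hT hT'
    rcases mem_union.1 hT' with h | h
    · rcases (mem_missing.1 h).2 with h | h
      · exact not_disjoint_of_mem_link hint hT hB h
      · exact not_disjoint_of_mem_link hint hT hC h
    · have := (subset_sdiff.1 (mem_powersetCard.1 (mem_filter.1 h).1).1).2
      exact not_disjoint_of_mem_link hint hT hD this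
  have hsub : link 1 F ∪ (missing s V B C ∪ E) ⊆ powersetCard s V := by
    refine union_subset hlink (union_subset (fun T hT => (mem_missing.1 hT).1) fun T hT => ?_)
    obtain ⟨h3, h4⟩ := mem_powersetCard.1 (mem_filter.1 hT).1
    exact mem_powersetCard.2 ⟨h3.trans sdiff_subset, h4⟩
  have h3 := card_le_card hsub
  rw [card_union_of_disjoint hdisj', card_union_of_disjoint hdisj, card_powersetCard, hV] at h3
  omega

lemma common_eq_inter {n k : ℕ} {F : Finset (Finset ℕ)} (hF : F ⊆ kSets n k) {B C : Finset ℕ}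
    (hB : B ∈ avoiding 1 F) (hC : C ∈ avoiding 1 F)
    (h : ∀ x ∈ B ∩ C, ∀ D ∈ avoiding 1 F, x ∈ D) : common n (avoiding 1 F) = B ∩ C := by
  ext x
  simp only [common, mem_filter, mem_inter]
  constructor
  · rintro ⟨-, h⟩
    exact ⟨h B hB, h C hC⟩
  · rintro ⟨h1, h2⟩
    exact ⟨(mem_kSets.1 (hF (mem_avoiding.1 hB).1)).1 h1, h x (mem_inter.2 ⟨h1, h2⟩)⟩

/-- If at least three members avoid `1` and do not have exactly `k - 1` common points, then three
of them exclude so many sets through `1` that `F` is smaller than `J n k 3`. -/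
lemma card_lt_of_three_le {r s : ℕ} (hs : 4 ≤ s) (hsr : s + 2 ≤ r) {F : Finset (Finset ℕ)}
    (hF : F ⊆ kSets (r + s + 2) (s + 1)) (hint : (F : Set (Finset ℕ)).Intersecting)
    (h3 : 3 ≤ #(avoiding 1 F)) (hr : #(avoiding 1 F) ≤ r + 1)
    (hcommon : #(common (r + s + 2) (avoiding 1 F)) ≠ s) :
    (#F : ℤ) < (r + s + 1).choose s - deficit r s := by
  have hV : #((Icc 1 (r + s + 2)).erase 1) = r + s + 1 := by
    rw [card_erase_of_mem (by simp), Nat.card_Icc]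
    omega
  have hlink : link 1 F ⊆ powersetCard s ((Icc 1 (r + s + 2)).erase 1) := link_subset hF
  have havoid : avoiding 1 F ⊆ powersetCard (s + 1) ((Icc 1 (r + s + 2)).erase 1) :=
    avoiding_subset hF
  have hexists : ∀ B ∈ avoiding 1 F, ∀ D ∈ avoiding 1 F, D ≠ B → ∃ x ∈ B, x ∉ D := by
    intro B hB D hD hDB
    by_contra! h
    exact hDB (eq_of_subset_of_card_le (fun x hx => h x hx) (by
      rw [(mem_powersetCard.1 (havoid hB)).2, (mem_powersetCard.1 (havoid hD)).2])).symm
  have hcard := card_link_add_card_avoiding 1 F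
  have hnum := add_two_le_choose (a := r - 2) (c := s - 2) (by omega) (by omega)
  have hp1 : (r - 1).choose s = (r - 2).choose (s - 1) + (r - 2).choose s := by
    obtain ⟨s, rfl⟩ : ∃ q, s = q + 1 := ⟨s - 1, by omega⟩
    obtain ⟨r, rfl⟩ : ∃ q, r = q + 2 := ⟨r - 2, by omega⟩
    exact Nat.choose_succ_succ' _ _
  have hp2 : (r - 1).choose (s - 1) = (r - 2).choose (s - 2) + (r - 2).choose (s - 1) := by
    obtain ⟨s, rfl⟩ : ∃ q, s = q + 2 := ⟨s - 2, by omega⟩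
    obtain ⟨r, rfl⟩ : ∃ q, r = q + 2 := ⟨r - 2, by omega⟩
    exact Nat.choose_succ_succ' _ _
  have hmono : (r - 2).choose s ≤ (r - 1).choose s := Nat.choose_le_choose _ (by omega)
  -- Either two members avoiding `1` share at most `k - 2` points and any third one serves as `D`,
  -- or all pairs share `k - 1` points and `D` is chosen to miss a point of `B ∩ C`.
  by_cases hpair : ∃ B ∈ avoiding 1 F, ∃ C ∈ avoiding 1 F, 2 ≤ #(B \ C)
  · obtain ⟨B, hB, C, hC, hBC⟩ := hpair
    obtain ⟨D, hD, hD'⟩ : ∃ D ∈ avoiding 1 F, D ∉ ({B, C} : Finset (Finset ℕ)) := by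
      by_contra! h
      have := card_le_card (fun D hD => h D hD : avoiding 1 F ⊆ {B, C})
      have := card_le_two (a := B) (b := C)
      omega
    simp only [mem_insert, mem_singleton, not_or] at hD'
    obtain ⟨x, hxB, hxD⟩ := hexists B hB D hD hD'.1
    obtain ⟨y, hyC, hyD⟩ := hexists C hC D hD hD'.2
    have hsub : {x, y} ⊆ (Icc 1 (r + s + 2)).erase 1 \ D := by
      intro z hz
      rcases mem_insert.1 hz with rfl | hz
      · exact mem_sdiff.2 ⟨(mem_powersetCard.1 (havoid hB)).1 hxB, hxD⟩
      · rw [mem_singleton.1 hz]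
        exact mem_sdiff.2 ⟨(mem_powersetCard.1 (havoid hC)).1 hyC, hyD⟩
    have hle : #{x, y} ≤ 2 := card_le_two
    have hpos : 0 < #{x, y} := card_pos.2 ⟨x, mem_insert_self _ _⟩
    have h := card_link_add_le hV hlink havoid hint hB hC hD hsub (by omega)
      (not_disjoint_iff.2 ⟨x, mem_insert_self _ _, hxB⟩)
      (not_disjoint_iff.2 ⟨y, mem_insert_of_mem (mem_singleton_self y), hyC⟩)
    have h5 : (r - #(B \ C)).choose s ≤ (r - 2).choose s := Nat.choose_le_choose _ (by omega)
    have h6 : (r - 2).choose (s - 2) ≤ (r - #{x, y}).choose (s - #{x, y}) := by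
      rcases (show #{x, y} = 1 ∨ #{x, y} = 2 by omega) with h | h
      · rw [h]; omega
      · rw [h]
    rw [deficit]
    omega
  · push Not at hpair
    obtain ⟨B, hB, C, hC, hBC⟩ := one_lt_card.1 (show 1 < #(avoiding 1 F) by omega)
    have h1 : #(B \ C) = 1 := by
      have := hpair B hB C hC
      have : 0 < #(B \ C) := by
        obtain ⟨x, hxB, hxC⟩ := hexists B hB C hC (Ne.symm hBC)
        exact card_pos.2 ⟨x, mem_sdiff.2 ⟨hxB, hxC⟩⟩
      omega
    have hinter : #(B ∩ C) = s := by
      have := card_inter_add_card_sdiff B C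
      have := (mem_powersetCard.1 (havoid hB)).2
      omega
    obtain ⟨x, hx, D, hD, hxD⟩ : ∃ x ∈ B ∩ C, ∃ D ∈ avoiding 1 F, x ∉ D := by
      by_contra! h
      rw [common_eq_inter hF hB hC h] at hcommon
      exact hcommon hinter
    obtain ⟨hxB, hxC⟩ := mem_inter.1 hx
    have h := card_link_add_le (Y := {x}) hV hlink havoid hint hB hC hD
      (singleton_subset_iff.2 (mem_sdiff.2 ⟨(mem_powersetCard.1 (havoid hB)).1 hxB, hxD⟩))
      (by simp; omega) (by simpa using hxB) (by simpa using hxC)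
    rw [h1, card_singleton] at h
    rw [deficit]
    omega

/-- The two sets `B` and `C` together with all `k`-subsets of `[n]` that contain `1` and meet
both of them. -/
def full (n k : ℕ) (B C : Finset ℕ) : Finset (Finset ℕ) :=
  {B, C} ∪ (kSets n k).filter (fun A => 1 ∈ A ∧ (A ∩ B).Nonempty ∧ (A ∩ C).Nonempty)

lemma J_eq_full (n k i : ℕ) : J n k i = full n k (I k 1) (I k i) := rfl

lemma mem_full {n k : ℕ} {A B C : Finset ℕ} : A ∈ full n k B C ↔
    (A = B ∨ A = C) ∨ A ∈ kSets n k ∧ 1 ∈ A ∧ (A ∩ B).Nonempty ∧ (A ∩ C).Nonempty := by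
  simp [full, or_assoc]

lemma card_full {r s : ℕ} {B C : Finset ℕ} (hB : B ∈ kSets (r + s + 2) (s + 1))
    (hC : C ∈ kSets (r + s + 2) (s + 1)) (h1B : 1 ∉ B) (h1C : 1 ∉ C) (hBC : B ≠ C) :
    #(full (r + s + 2) (s + 1) B C) + 2 * r.choose s =
      (r + s + 1).choose s + (r - #(B \ C)).choose s + 2 := by
  obtain ⟨hBV, hBc⟩ := mem_kSets.1 hB
  obtain ⟨hCV, hCc⟩ := mem_kSets.1 hC
  set V := (Icc 1 (r + s + 2)).erase 1 with hVdef
  have hone : 1 ∈ Icc 1 (r + s + 2) := by simp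
  have hV : #V = r + s + 1 := by
    rw [card_erase_of_mem hone, Nat.card_Icc]
    omega
  have h1 := card_missing hV (subset_erase.2 ⟨hBV, h1B⟩) (subset_erase.2 ⟨hCV, h1C⟩) hBc hCc
  have havoid : avoiding 1 (full (r + s + 2) (s + 1) B C) = {B, C} := by
    ext A
    rw [mem_avoiding, mem_full, mem_insert, mem_singleton]
    constructor
    · rintro ⟨h | h, h'⟩
      · exact h
      · exact absurd h.2.1 h'
    · intro h
      refine ⟨Or.inl h, ?_⟩
      rcases h with rfl | rfl <;> assumption
  have hlink : link 1 (full (r + s + 2) (s + 1) B C) = powersetCard s V \ missing s V B C := by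
    ext T
    rw [mem_link, mem_full, mem_sdiff, mem_missing, mem_powersetCard]
    have e1 : 1 ∉ T → (insert 1 T ∈ kSets (r + s + 2) (s + 1) ↔ T ⊆ V ∧ #T = s) := by
      intro h
      rw [mem_kSets, card_insert_of_notMem h, insert_subset_iff, hVdef, subset_erase]
      constructor
      · rintro ⟨⟨-, h2⟩, h3⟩
        exact ⟨⟨h2, h⟩, by omega⟩
      · rintro ⟨⟨h2, -⟩, h3⟩
        exact ⟨⟨hone, h2⟩, by omega⟩
    have e2 : ∀ X : Finset ℕ, 1 ∉ X → ((insert 1 T ∩ X).Nonempty ↔ ¬ Disjoint T X) := by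
      intro X hX
      rw [insert_inter_of_notMem hX, not_disjoint_iff_nonempty_inter]
    rw [e2 B h1B, e2 C h1C]
    constructor
    · rintro ⟨h1T, (h | h) | ⟨h, -, h2, h3⟩⟩
      · exact absurd (h ▸ mem_insert_self 1 T) h1B
      · exact absurd (h ▸ mem_insert_self 1 T) h1C
      · refine ⟨(e1 h1T).1 h, ?_⟩
        tauto
    · rintro ⟨h, h'⟩
      have h1T : 1 ∉ T := fun h1 => notMem_erase 1 _ (h.1 h1)
      refine ⟨h1T, Or.inr ⟨(e1 h1T).2 h, mem_insert_self _ _, ?_, ?_⟩⟩ <;> tauto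
  have h2 := card_link_add_card_avoiding 1 (full (r + s + 2) (s + 1) B C)
  have hsub : missing s V B C ⊆ powersetCard s V := fun T hT => (mem_missing.1 hT).1
  have h3 := card_le_card hsub
  rw [hlink, havoid, card_pair hBC, card_sdiff_of_subset hsub] at h2
  rw [card_powersetCard, hV] at h2 h3
  omega

lemma I_mem_kSets {r s i : ℕ} (hi : i ≤ r + 1) : I (s + 1) i ∈ kSets (r + s + 2) (s + 1) := by
  refine mem_kSets.2 ⟨Icc_subset_Icc (by omega) (by omega), ?_⟩
  rw [I, Nat.card_Icc]
  omega

lemma one_notMem_I {k i : ℕ} (hi : 1 ≤ i) : 1 ∉ I k i := by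
  rw [I, mem_Icc]
  omega

lemma card_I_sdiff {k i : ℕ} (h1 : 1 ≤ i) (hi : i ≤ k) : #(I k 1 \ I k i) = i - 1 := by
  have : I k 1 \ I k i = Icc 2 i := by
    ext x
    simp only [I, mem_sdiff, mem_Icc]
    omega
  rw [this, Nat.card_Icc]
  omega

lemma card_J {r s i : ℕ} (hsr : s + 1 ≤ r) (h2 : 2 ≤ i) (hi : i ≤ s + 1) :
    #(J (r + s + 2) (s + 1) i) + 2 * r.choose s =
      (r + s + 1).choose s + (r - (i - 1)).choose s + 2 := by
  have hd := card_I_sdiff (k := s + 1) (by omega) hi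
  rw [J_eq_full, ← hd]
  refine card_full (I_mem_kSets (by omega)) (I_mem_kSets (by omega)) (one_notMem_I le_rfl)
    (one_notMem_I (by omega)) fun h => ?_
  rw [h, sdiff_self, bot_eq_empty, card_empty] at hd
  omega

/-- If exactly two members `B`, `C` avoid `1` and they share fewer than `k - 1` points, then `F` has
at most as many members as `J n k 3`, and with equality it contains every set through `1` that meets
`B` and `C`. -/
lemma eq_full_of_card_avoiding_eq_two {r s : ℕ} (hs : 4 ≤ s) (hsr : s + 1 ≤ r)
    {F : Finset (Finset ℕ)} (hF : F ⊆ kSets (r + s + 2) (s + 1))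
    (hint : (F : Set (Finset ℕ)).Intersecting)
    (hcard : ((r + s + 1).choose s : ℤ) - deficit r s ≤ #F) (h2 : #(avoiding 1 F) = 2)
    (hcommon : #(common (r + s + 2) (avoiding 1 F)) ≠ s) :
    ∃ B ∈ kSets (r + s + 2) (s + 1), ∃ C ∈ kSets (r + s + 2) (s + 1), 1 ∉ B ∧ 1 ∉ C ∧
      2 ≤ #(B \ C) ∧ #(B \ C) ≤ s ∧ (s + 2 ≤ r → #(B \ C) = 2) ∧
      F = full (r + s + 2) (s + 1) B C ∧ (#F : ℤ) = (r + s + 1).choose s - deficit r s := by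
  obtain ⟨B, C, hBC, hav⟩ := card_eq_two.1 h2
  have hB : B ∈ avoiding 1 F := by rw [hav]; simp
  have hC : C ∈ avoiding 1 F := by rw [hav]; simp
  obtain ⟨hBF, h1B⟩ := mem_avoiding.1 hB
  obtain ⟨hCF, h1C⟩ := mem_avoiding.1 hC
  have hBc := (mem_kSets.1 (hF hBF)).2
  have hCc := (mem_kSets.1 (hF hCF)).2
  have hadd := card_inter_add_card_sdiff B C
  have hpos : 0 < #(B ∩ C) := card_pos.2 (not_disjoint_iff_nonempty_inter.1 (hint hBF hCF))
  have hne0 : #(B \ C) ≠ 0 := by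
    rw [Ne, card_eq_zero, sdiff_eq_empty_iff_subset]
    exact fun h => hBC (eq_of_subset_of_card_le h (by omega))
  have hne1 : #(B \ C) ≠ 1 := by
    intro h
    refine hcommon ?_
    rw [common_eq_inter hF hB hC]
    · omega
    · intro x hx D hD
      obtain ⟨hxB, hxC⟩ := mem_inter.1 hx
      rw [hav, mem_insert, mem_singleton] at hD
      rcases hD with rfl | rfl <;> assumption
  have hsub : F ⊆ full (r + s + 2) (s + 1) B C := by
    intro A hA
    rw [mem_full]
    by_cases h1A : 1 ∈ A
    · exact Or.inr ⟨hF hA, h1A, not_disjoint_iff_nonempty_inter.1 (hint hA hBF),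
        not_disjoint_iff_nonempty_inter.1 (hint hA hCF)⟩
    · have : A ∈ avoiding 1 F := mem_avoiding.2 ⟨hA, h1A⟩
      rw [hav, mem_insert, mem_singleton] at this
      exact Or.inl this
  have hfull := card_full (hF hBF) (hF hCF) h1B h1C hBC
  have hle := card_le_card hsub
  have hmono : (r - #(B \ C)).choose s ≤ (r - 2).choose s := Nat.choose_le_choose _ (by omega)
  rw [deficit] at hcard ⊢
  refine ⟨B, hF hBF, C, hF hCF, h1B, h1C, by omega, by omega, ?_,
    eq_of_subset_of_card_le hsub (by omega), by omega⟩
  intro hr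
  by_contra hne
  -- for `r ≥ s + 2` the number `(r - j choose s)` drops strictly from `j = 2` to `j = 3`
  have h3 : (r - #(B \ C)).choose s ≤ (r - 3).choose s := Nat.choose_le_choose _ (by omega)
  have h4 : (r - 2).choose s = (r - 3).choose (s - 1) + (r - 3).choose s := by
    obtain ⟨s, rfl⟩ : ∃ q, s = q + 1 := ⟨s - 1, by omega⟩
    obtain ⟨r, rfl⟩ : ∃ q, r = q + 3 := ⟨r - 3, by omega⟩
    exact Nat.choose_succ_succ' _ _
  have h5 : 0 < (r - 3).choose (s - 1) := Nat.choose_pos (by omega)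
  omega

/-! ### Isomorphisms and the structure theorem -/

/-- The members of a family moved by a permutation of the ground set. -/
def permute (σ : Equiv.Perm ℕ) (F : Finset (Finset ℕ)) : Finset (Finset ℕ) :=
  F.image fun A => A.image σ

lemma card_permute (σ : Equiv.Perm ℕ) (F : Finset (Finset ℕ)) : #(permute σ F) = #F :=
  card_image_of_injective _ (image_injective σ.injective)

lemma permute_subset_kSets {n k : ℕ} {σ : Equiv.Perm ℕ} {F : Finset (Finset ℕ)}
    (hσ : (Icc 1 n).image σ = Icc 1 n) (hF : F ⊆ kSets n k) : permute σ F ⊆ kSets n k := by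
  intro A hA
  obtain ⟨B, hB, rfl⟩ := mem_image.1 hA
  obtain ⟨h1, h2⟩ := mem_kSets.1 (hF hB)
  refine mem_kSets.2 ⟨?_, by rw [card_image_of_injective _ σ.injective, h2]⟩
  rw [← hσ]
  exact image_subset_image h1

lemma intersecting_permute {σ : Equiv.Perm ℕ} {F : Finset (Finset ℕ)}
    (hint : (F : Set (Finset ℕ)).Intersecting) :
    (permute σ F : Set (Finset ℕ)).Intersecting := by
  intro A hA B hB
  obtain ⟨A, hA', rfl⟩ := mem_image.1 (mem_coe.1 hA)
  obtain ⟨B, hB', rfl⟩ := mem_image.1 (mem_coe.1 hB)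
  rw [disjoint_image σ.injective]
  exact hint hA' hB'

lemma avoiding_permute (σ : Equiv.Perm ℕ) (i : ℕ) (F : Finset (Finset ℕ)) :
    avoiding (σ i) (permute σ F) = permute σ (avoiding i F) := by
  rw [avoiding, permute, permute, avoiding, filter_image]
  simp [σ.injective.eq_iff]

lemma Iso.refl (n : ℕ) (F : Finset (Finset ℕ)) : Iso n F F :=
  ⟨1, by simp, by simp⟩

lemma Iso.trans {n : ℕ} {F G H : Finset (Finset ℕ)} (h1 : Iso n F G) (h2 : Iso n G H) :
    Iso n F H := by
  obtain ⟨σ, hσ, rfl⟩ := h1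
  obtain ⟨τ, hτ, rfl⟩ := h2
  refine ⟨σ.trans τ, ?_, ?_⟩
  · rw [Equiv.coe_trans, ← image_image, hσ, hτ]
  · rw [image_image]
    exact image_congr fun A _ => by
      simp only [Function.comp_apply, image_image, Equiv.coe_trans]

lemma SubE.of_iso {n k l : ℕ} {F G : Finset (Finset ℕ)} (h : Iso n F G) (hG : SubE n k l G) :
    SubE n k l F := by
  obtain ⟨E, H, hE, hH, hHE⟩ := hG
  exact ⟨E, H, hE, h.trans hH, hHE⟩

/-- Every family with the defining property of `E_l` extends to a maximal one. -/
lemma EProp.subE {n k l : ℕ} {F G : Finset (Finset ℕ)} (hG : EProp n k l G) (hFG : F ⊆ G) :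
    SubE n k l F := by
  have hfin : {H | EProp n k l H}.Finite :=
    (kSets n k).powerset.finite_toSet.subset fun H hH => mem_coe.2 (mem_powerset.2 hH.subset_kSets)
  obtain ⟨E, hGE, hE⟩ := hfin.exists_le_maximal hG
  exact ⟨E, F, hE, Iso.refl n F, hFG.trans hGE⟩

/-- If at least `k` members avoid `1` and share `k - 1` elements, then every other member meets
that common core, so all `n - k` sets through the core can be added. -/
lemma subE_of_le_card_avoiding {n k : ℕ} (hk : 2 ≤ k) (hkn : k ≤ n)
    {F : Finset (Finset ℕ)} (hF : F ⊆ kSets n k)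
    (hint : (F : Set (Finset ℕ)).Intersecting) (hl : k ≤ #(avoiding 1 F))
    (hcommon : #(common n (avoiding 1 F)) + 1 = k) : SubE n k (n - k) F := by
  set K := common n (avoiding 1 F) with hK
  have hmemK : ∀ x, x ∈ K ↔ x ∈ Icc 1 n ∧ ∀ A ∈ avoiding 1 F, x ∈ A := fun x => mem_filter
  have hKsub : ∀ A ∈ avoiding 1 F, K ⊆ A := fun A hA x hx => ((hmemK x).1 hx).2 A hA
  have hKV : K ⊆ Icc 1 n := fun x hx => ((hmemK x).1 hx).1
  obtain ⟨A₀, hA₀⟩ := card_pos.1 (show 0 < #(avoiding 1 F) by omega)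
  have h1K : 1 ∉ K := fun h => (mem_avoiding.1 hA₀).2 (hKsub A₀ hA₀ h)
  have hcore : K.Nonempty := card_pos.1 (by omega)
  -- every member avoiding `1` is the core with one point added
  have hform : ∀ A ∈ avoiding 1 F, ∃ x ∈ (Icc 1 n).erase 1 \ K, A = insert x K := by
    intro A hA
    obtain ⟨hAF, h1A⟩ := mem_avoiding.1 hA
    obtain ⟨hAV, hAc⟩ := mem_kSets.1 (hF hAF)
    obtain ⟨x, hx⟩ := card_eq_one.1 (show #(A \ K) = 1 by
      rw [card_sdiff_of_subset (hKsub A hA)]; omega)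
    have hxA : x ∈ A \ K := by rw [hx]; exact mem_singleton_self x
    obtain ⟨hxA, hxK⟩ := mem_sdiff.1 hxA
    refine ⟨x, mem_sdiff.2 ⟨mem_erase.2 ⟨fun h => h1A (h ▸ hxA), hAV hxA⟩, hxK⟩, ?_⟩
    rw [insert_eq, ← hx, sdiff_union_of_subset (hKsub A hA)]
  have hmeet : ∀ A ∈ F, 1 ∈ A → ¬ Disjoint A K := by
    intro A hA h1A hdisj
    have hle : #(avoiding 1 F) ≤ #(A.erase 1) := by
      have hsub : avoiding 1 F ⊆ (A.erase 1).image fun x => insert x K := by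
        intro B hB
        obtain ⟨x, hx, rfl⟩ := hform B hB
        obtain ⟨y, hyA, hyB⟩ := not_disjoint_iff.1 (hint hA (mem_avoiding.1 hB).1)
        rcases mem_insert.1 hyB with rfl | hyK
        · exact mem_image_of_mem _
            (mem_erase.2 ⟨fun h => (mem_avoiding.1 hB).2 (h ▸ hyB), hyA⟩)
        · exact absurd hyK (disjoint_left.1 hdisj hyA)
      exact (card_le_card hsub).trans card_image_le
    rw [card_erase_of_mem h1A, (mem_kSets.1 (hF hA)).2] at hle
    omega
  set N := ((Icc 1 n).erase 1 \ K).image fun x => insert x K with hN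
  have hNK : ∀ B ∈ N, K ⊆ B := by
    intro B hB
    obtain ⟨x, -, rfl⟩ := mem_image.1 hB
    exact subset_insert _ _
  have hN1 : ∀ B ∈ N, 1 ∉ B := by
    intro B hB h
    obtain ⟨x, hx, rfl⟩ := mem_image.1 hB
    rcases mem_insert.1 h with rfl | h
    · exact notMem_erase _ _ (mem_sdiff.1 hx).1
    · exact h1K h
  have hNcard : #N = n - k := by
    rw [hN, card_image_of_injOn, card_sdiff_of_subset (subset_erase.2 ⟨hKV, h1K⟩),
      card_erase_of_mem (mem_Icc.2 ⟨le_rfl, by omega⟩), Nat.card_Icc]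
    · omega
    · intro x hx y hy hxy
      have hxK := (mem_sdiff.1 (mem_coe.1 hx)).2
      have : x ∈ insert y K := by
        rw [← show insert x K = insert y K from hxy]
        exact mem_insert_self x K
      rcases mem_insert.1 this with h | h
      · exact h
      · exact absurd h hxK
  have hav : avoiding 1 (F ∪ N) = N := by
    ext A
    rw [mem_avoiding, mem_union]
    constructor
    · rintro ⟨h | h, h1⟩
      · obtain ⟨x, hx, rfl⟩ := hform A (mem_avoiding.2 ⟨h, h1⟩)
        exact mem_image_of_mem _ hx
      · exact h
    · exact fun h => ⟨Or.inr h, hN1 A h⟩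
  have havN : avoiding 1 F ⊆ N := by
    intro A hA
    obtain ⟨x, hx, rfl⟩ := hform A hA
    exact mem_image_of_mem _ hx
  refine EProp.subE (G := F ∪ N) ⟨?_, ?_, ?_, ?_⟩ subset_union_left
  · refine union_subset hF fun B hB => ?_
    obtain ⟨x, hx, rfl⟩ := mem_image.1 hB
    obtain ⟨hx1, hxK⟩ := mem_sdiff.1 hx
    exact mem_kSets.2 ⟨insert_subset (mem_of_mem_erase hx1) hKV, by
      rw [card_insert_of_notMem hxK, hcommon]⟩
  · have hNF : ∀ B ∈ N, ∀ A ∈ F, ¬ Disjoint A B := by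
      intro B hB A hA
      by_cases h1A : 1 ∈ A
      · exact fun h => hmeet A hA h1A (h.mono_right (hNK B hB))
      · obtain ⟨x, hx⟩ := hcore
        exact not_disjoint_iff.2 ⟨x, hKsub A (mem_avoiding.2 ⟨hA, h1A⟩) hx, hNK B hB hx⟩
    intro A hA B hB
    rcases mem_union.1 (mem_coe.1 hA) with hA | hA
    · rcases mem_union.1 (mem_coe.1 hB) with hB | hB
      · exact hint hA hB
      · exact hNF B hB A hA
    · rcases mem_union.1 (mem_coe.1 hB) with hB | hB
      · exact fun h => hNF A hA B hB h.symm
      · obtain ⟨x, hx⟩ := hcore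
        exact not_disjoint_iff.2 ⟨x, hNK A hA hx, hNK B hB hx⟩
  · rw [hav, hNcard]
  · intro _
    rw [hav, ← hcommon]
    congr 2
    ext x
    rw [hmemK, common, mem_filter]
    refine and_congr_right fun hx => ⟨fun h A hA => h A (havN hA), fun h A hA => hNK A hA ?_⟩
    exact (hmemK x).2 ⟨hx, h⟩

/-- A colouring of `ℕ` that records the position of a point relative to `1`, `[n]`, `B`
and `C`. -/
def colour (n : ℕ) (B C : Finset ℕ) (x : ℕ) : ℕ :=
  if x = 1 then 0 else if x ∉ Icc 1 n then 1 else
    if x ∈ B then (if x ∈ C then 2 else 3) else (if x ∈ C then 4 else 5)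

lemma colour_spec {n k : ℕ} (hn : 1 ≤ n) {B C : Finset ℕ} (hB : B ∈ kSets n k)
    (hC : C ∈ kSets n k) (h1B : 1 ∉ B) (h1C : 1 ∉ C) (x : ℕ) :
    (colour n B C x = 0 ↔ x = 1) ∧ (colour n B C x = 1 ↔ x ∉ Icc 1 n) ∧
      (colour n B C x = 2 ↔ x ∈ B ∩ C) ∧ (colour n B C x = 3 ↔ x ∈ B \ C) ∧
      (colour n B C x = 4 ↔ x ∈ C \ B) ∧
      (colour n B C x = 5 ↔ x ∈ (Icc 1 n).erase 1 \ (B ∪ C)) ∧ colour n B C x < 6 := by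
  simp only [mem_inter, mem_sdiff, mem_erase, mem_union]
  rw [colour]
  by_cases p1 : x = 1
  · subst p1
    simp [h1B, h1C, hn]
  by_cases p2 : x ∈ Icc 1 n
  · by_cases p3 : x ∈ B <;> by_cases p4 : x ∈ C <;> simp [p1, p2, p3, p4, -mem_Icc]
  · have p3 : x ∉ B := fun h => p2 ((mem_kSets.1 hB).1 h)
    have p4 : x ∉ C := fun h => p2 ((mem_kSets.1 hC).1 h)
    simp [p1, p2, p3, p4, -mem_Icc]

/-- A permutation of the ground set that fixes `1` and carries one pair of `k`-sets to another pair
with the same intersection size. -/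
lemma exists_perm {n k : ℕ} (hn : 1 ≤ n) {B C B' C' : Finset ℕ} (hB : B ∈ kSets n k)
    (hC : C ∈ kSets n k) (hB' : B' ∈ kSets n k) (hC' : C' ∈ kSets n k) (h1B : 1 ∉ B)
    (h1C : 1 ∉ C) (h1B' : 1 ∉ B') (h1C' : 1 ∉ C') (h : #(B \ C) = #(B' \ C')) :
    ∃ σ : Equiv.Perm ℕ, σ 1 = 1 ∧ (Icc 1 n).image σ = Icc 1 n ∧ B.image σ = B' ∧
      C.image σ = C' := by
  have spec := colour_spec hn hB hC h1B h1C
  have spec' := colour_spec hn hB' hC' h1B' h1C'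
  have hfib : ∀ c, Nonempty ({x // colour n B C x = c} ≃ {x // colour n B' C' x = c}) := by
    have mk : ∀ (c : ℕ) (S S' : Finset ℕ), (∀ x, colour n B C x = c ↔ x ∈ S) →
        (∀ x, colour n B' C' x = c ↔ x ∈ S') → #S = #S' →
        Nonempty ({x // colour n B C x = c} ≃ {x // colour n B' C' x = c}) :=
      fun c S S' h1 h2 h3 => ⟨(Equiv.subtypeEquivRight h1).trans
        ((equivOfCardEq h3).trans (Equiv.subtypeEquivRight h2).symm)⟩
    obtain ⟨hBV, hBc⟩ := mem_kSets.1 hB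
    obtain ⟨hCV, hCc⟩ := mem_kSets.1 hC
    obtain ⟨hBV', hBc'⟩ := mem_kSets.1 hB'
    obtain ⟨hCV', hCc'⟩ := mem_kSets.1 hC'
    have e1 := card_inter_add_card_sdiff B C
    have e2 := card_inter_add_card_sdiff B' C'
    have e3 := card_inter_add_card_sdiff C B
    have e4 := card_inter_add_card_sdiff C' B'
    rw [inter_comm] at e3 e4
    have e5 := card_sdiff_add_card B C
    have e6 := card_sdiff_add_card B' C'
    intro c
    rcases lt_or_ge c 6 with hc | hc
    · interval_cases c
      · exact mk 0 {1} {1} (fun x => by rw [(spec x).1, mem_singleton])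
          (fun x => by rw [(spec' x).1, mem_singleton]) rfl
      · exact ⟨Equiv.subtypeEquivRight fun x => by rw [(spec x).2.1, (spec' x).2.1]⟩
      · exact mk 2 _ _ (fun x => (spec x).2.2.1) (fun x => (spec' x).2.2.1) (by omega)
      · exact mk 3 _ _ (fun x => (spec x).2.2.2.1) (fun x => (spec' x).2.2.2.1) h
      · exact mk 4 _ _ (fun x => (spec x).2.2.2.2.1) (fun x => (spec' x).2.2.2.2.1) (by omega)
      · refine mk 5 _ _ (fun x => (spec x).2.2.2.2.2.1) (fun x => (spec' x).2.2.2.2.2.1) ?_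
        rw [card_sdiff_of_subset, card_sdiff_of_subset]
        · omega
        · exact subset_erase.2 ⟨union_subset hBV' hCV', by simp [h1B', h1C']⟩
        · exact subset_erase.2 ⟨union_subset hBV hCV, by simp [h1B, h1C]⟩
    · refine mk c ∅ ∅ (fun x => ?_) (fun x => ?_) rfl
      · have := (spec x).2.2.2.2.2.2
        simp only [notMem_empty, iff_false]
        omega
      · have := (spec' x).2.2.2.2.2.2
        simp only [notMem_empty, iff_false]
        omega
  let σ : Equiv.Perm ℕ := Equiv.ofFiberEquiv fun c => (hfib c).some
  have hσ : ∀ x, colour n B' C' (σ x) = colour n B C x := fun x => Equiv.ofFiberEquiv_map _ x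
  have himage : ∀ X Y : Finset ℕ, (∀ x, σ x ∈ Y ↔ x ∈ X) → X.image σ = Y := by
    intro X Y hXY
    ext y
    rw [mem_image]
    constructor
    · rintro ⟨x, hx, rfl⟩
      exact (hXY x).2 hx
    · intro hy
      exact ⟨σ.symm y, (hXY _).1 (by simpa using hy), by simp⟩
  refine ⟨σ, ?_, himage _ _ fun x => ?_, himage _ _ fun x => ?_, himage _ _ fun x => ?_⟩
  · rw [← (spec' _).1, hσ, (spec 1).1]
  · rw [← not_iff_not, ← (spec' _).2.1, hσ, (spec x).2.1]
  · rw [← sdiff_union_inter B C, ← sdiff_union_inter B' C', mem_union, mem_union,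
      ← (spec' _).2.2.1, ← (spec' _).2.2.2.1, hσ, (spec x).2.2.1, (spec x).2.2.2.1]
  · rw [← sdiff_union_inter C B, ← sdiff_union_inter C' B', mem_union, mem_union, inter_comm C B,
      inter_comm C' B', ← (spec' _).2.2.1, ← (spec' _).2.2.2.2.1, hσ, (spec x).2.2.1,
      (spec x).2.2.2.2.1]

lemma iso_full {r s : ℕ} {B C B' C' : Finset ℕ} (hB : B ∈ kSets (r + s + 2) (s + 1))
    (hC : C ∈ kSets (r + s + 2) (s + 1)) (hB' : B' ∈ kSets (r + s + 2) (s + 1))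
    (hC' : C' ∈ kSets (r + s + 2) (s + 1)) (h1B : 1 ∉ B) (h1C : 1 ∉ C) (h1B' : 1 ∉ B')
    (h1C' : 1 ∉ C') (hpos : 0 < #(B \ C)) (h : #(B \ C) = #(B' \ C')) :
    Iso (r + s + 2) (full (r + s + 2) (s + 1) B C) (full (r + s + 2) (s + 1) B' C') := by
  obtain ⟨σ, h1, hσ, hσB, hσC⟩ := exists_perm (by omega) hB hC hB' hC' h1B h1C h1B' h1C' h
  have hne : ∀ X Y : Finset ℕ, 0 < #(X \ Y) → X ≠ Y := by
    rintro X Y hXY rfl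
    simp at hXY
  refine ⟨σ, hσ, eq_of_subset_of_card_le ?_ ?_⟩
  · intro A hA
    obtain ⟨A, hA', rfl⟩ := mem_image.1 hA
    rw [mem_full] at hA' ⊢
    rcases hA' with (rfl | rfl) | ⟨hA', h1A, hAB, hAC⟩
    · exact Or.inl (Or.inl hσB)
    · exact Or.inl (Or.inr hσC)
    · refine Or.inr ⟨?_, ?_, ?_, ?_⟩
      · exact permute_subset_kSets (F := {A}) hσ (singleton_subset_iff.2 hA')
          (by simp [permute])
      · rw [← h1]
        exact mem_image_of_mem _ h1A
      · rw [← hσB, ← image_inter _ _ σ.injective]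
        exact hAB.image _
      · rw [← hσC, ← image_inter _ _ σ.injective]
        exact hAC.image _
  · have e1 := card_full hB hC h1B h1C (hne _ _ hpos)
    have e2 := card_full hB' hC' h1B' h1C' (hne _ _ (h ▸ hpos))
    change _ ≤ #(permute σ (full (r + s + 2) (s + 1) B C))
    rw [card_permute]
    rw [h] at e1
    omega

/-- The structure theorem for a family in which few members avoid `1`. -/
lemma subE_or_iso_of_card_avoiding_le {r s : ℕ} (hs : 4 ≤ s) (hsr : s + 1 ≤ r)
    {F : Finset (Finset ℕ)} (hF : F ⊆ kSets (r + s + 2) (s + 1))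
    (hint : (F : Set (Finset ℕ)).Intersecting)
    (hcard : ((r + s + 1).choose s : ℤ) - deficit r s ≤ #F) (hav : #(avoiding 1 F) ≤ r + 1) :
    (∃ l, (l ≤ s ∨ l = r + 1) ∧ SubE (r + s + 2) (s + 1) l F) ∨
      (#F : ℤ) = (r + s + 1).choose s - deficit r s ∧
        ∃ i, 3 ≤ i ∧ i ≤ s + 1 ∧ (s + 2 ≤ r → i = 3) ∧
          Iso (r + s + 2) F (J (r + s + 2) (s + 1) i) := by
  by_cases hE : 2 ≤ #(avoiding 1 F) → #(common (r + s + 2) (avoiding 1 F)) + 1 = s + 1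
  · left
    rcases le_or_gt #(avoiding 1 F) s with hl | hl
    · exact ⟨_, Or.inl hl, EProp.subE ⟨hF, hint, rfl, hE⟩ subset_rfl⟩
    · refine ⟨r + 1, Or.inr rfl, ?_⟩
      have := subE_of_le_card_avoiding (by omega) (by omega) hF hint hl (hE (by omega))
      rwa [show r + s + 2 - (s + 1) = r + 1 by omega] at this
  · push Not at hE
    obtain ⟨h2, hcommon⟩ := hE
    have hcommon' : #(common (r + s + 2) (avoiding 1 F)) ≠ s := fun h => hcommon (by omega)
    rcases h2.eq_or_lt with h2 | h3
    · right
      obtain ⟨B, hB, C, hC, h1B, h1C, hd2, hds, hdr, hfull, heq⟩ :=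
        eq_full_of_card_avoiding_eq_two hs hsr hF hint hcard h2.symm hcommon'
      refine ⟨heq, #(B \ C) + 1, by omega, by omega, fun h => by rw [hdr h], ?_⟩
      rw [hfull, J_eq_full]
      refine iso_full hB hC (I_mem_kSets (by omega)) (I_mem_kSets (by omega)) h1B h1C
        (one_notMem_I le_rfl) (one_notMem_I (by omega)) (by omega) ?_
      rw [card_I_sdiff (by omega) (by omega)]
      omega
    · exfalso
      rcases (show r = s + 1 ∨ s + 2 ≤ r by omega) with rfl | hr
      · have h := (shadowGain_of_three_le hs h3 hav).card_add_le (x := s + 1)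
          (V := (Icc 1 (s + 1 + s + 2)).erase 1)
          (by rw [card_erase_of_mem (by simp), Nat.card_Icc]; omega)
          (avoiding_subset hF) (link_subset hF)
          (fun A hA B hB h => not_disjoint_of_mem_link hint hB hA h.symm) le_rfl
        rw [card_erase_of_mem (by simp), Nat.card_Icc] at h
        have e : s + 1 + s + 2 + 1 - 1 - 1 = s + 1 + s + 1 := by omega
        rw [e] at h
        have := card_link_add_card_avoiding 1 F
        omega
      · have := card_lt_of_three_le hs hr hF hint h3 hav hcommon'
        omega

lemma subE_or_iso_of_le_card {r s : ℕ} (hs : 4 ≤ s) (hsr : s + 1 ≤ r)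
    {F : Finset (Finset ℕ)} (hF : F ⊆ kSets (r + s + 2) (s + 1))
    (hint : (F : Set (Finset ℕ)).Intersecting)
    (hcard : ((r + s + 1).choose s : ℤ) - deficit r s ≤ #F) :
    (∃ l, (l ≤ s ∨ l = r + 1) ∧ SubE (r + s + 2) (s + 1) l F) ∨
      (#F : ℤ) = (r + s + 1).choose s - deficit r s ∧
        ∃ i, 3 ≤ i ∧ i ≤ s + 1 ∧ (s + 2 ≤ r → i = 3) ∧
          Iso (r + s + 2) F (J (r + s + 2) (s + 1) i) := by
  obtain ⟨c, hc, hcav⟩ := exists_card_avoiding_le_of_le_card hs hsr hF hint hcard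
  -- move the centre `c` to `1`
  let σ : Equiv.Perm ℕ := Equiv.swap c 1
  have hσ : (Icc 1 (r + s + 2)).image σ = Icc 1 (r + s + 2) := by
    refine eq_of_subset_of_card_le ?_ (by rw [card_image_of_injective _ σ.injective])
    intro y hy
    obtain ⟨x, hx, rfl⟩ := mem_image.1 hy
    simp only [σ, Equiv.swap_apply_def]
    split_ifs
    · simp
    · exact hc
    · exact hx
  have hiso : Iso (r + s + 2) F (permute σ F) := ⟨σ, hσ, rfl⟩
  have hσc : σ c = 1 := Equiv.swap_apply_left _ _
  have hav : #(avoiding 1 (permute σ F)) ≤ r + 1 := by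
    have := avoiding_permute σ c F
    rw [hσc] at this
    rwa [this, card_permute]
  rcases subE_or_iso_of_card_avoiding_le hs hsr (permute_subset_kSets hσ hF)
    (intersecting_permute hint) (by rwa [card_permute]) hav with ⟨l, hl, h⟩ | ⟨h, i, h3, hi, hr, hI⟩
  · exact Or.inl ⟨l, hl, h.of_iso hiso⟩
  · rw [card_permute] at h
    exact Or.inr ⟨h, i, h3, hi, hr, hiso.trans hI⟩

end LargeIntersecting

theorem corollary5 (n k : ℕ) (hk : 10 ≤ 2 * k) (hn : 2 * k < n)
    (F : Finset (Finset ℕ)) (hF : F ⊆ LargeIntersecting.kSets n k)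
    (hint : (F : Set (Finset ℕ)).Intersecting) :
    ((LargeIntersecting.J n k 3).card < F.card →
      ∃ l : ℕ, (l ≤ k - 1 ∨ l = n - k) ∧ LargeIntersecting.SubE n k l F) ∧
    (F.card = (LargeIntersecting.J n k 3).card →
      (∀ l : ℕ, (l ≤ k - 1 ∨ l = n - k) → ¬ LargeIntersecting.SubE n k l F) →
      (2 * k + 2 ≤ n → LargeIntersecting.Iso n F (LargeIntersecting.J n k 3)) ∧
      (n = 2 * k + 1 → ∃ i : ℕ, 3 ≤ i ∧ i ≤ k ∧
        LargeIntersecting.Iso n F (LargeIntersecting.J n k i))) := by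
  obtain ⟨s, rfl⟩ : ∃ s, k = s + 1 := ⟨k - 1, by omega⟩
  obtain ⟨r, rfl⟩ : ∃ r, n = r + s + 2 := ⟨n - s - 2, by omega⟩
  have hJ := LargeIntersecting.card_J (r := r) (s := s) (i := 3) (by omega) (by omega) (by omega)
  have hJ' : ((LargeIntersecting.J (r + s + 2) (s + 1) 3).card : ℤ) =
      (r + s + 1).choose s - LargeIntersecting.deficit r s := by
    rw [LargeIntersecting.deficit]
    change _ + _ = _ + (r - 2).choose s + 2 at hJ
    omega
  have e1 : s + 1 - 1 = s := rfl
  have e2 : r + s + 2 - (s + 1) = r + 1 := by omega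
  have main := LargeIntersecting.subE_or_iso_of_le_card (r := r) (s := s) (by omega) (by omega)
    hF hint
  rw [← hJ'] at main
  rw [e1, e2]
  constructor
  · intro h
    rcases main (by omega) with h' | ⟨h', -⟩
    · exact h'
    · omega
  · intro h hno
    rcases main (by omega) with ⟨l, hl, h'⟩ | ⟨-, i, h3, hi, hr, hI⟩
    · exact absurd h' (hno l hl)
    · refine ⟨fun h' => ?_, fun _ => ⟨i, h3, hi, hI⟩⟩
      rw [← hr (by omega)]
      exact hI
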